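/- **Setting.** A counting measure $\sum_i\delta_{x_i}$ on $(0,\infty)$ with $0<\sum_i x_i<\infty$ is self-normalized by $\mathcal V(\sum_i\delta_{x_i})=\sum_i\delta_{x_i/\sum_j x_j}$; likewise $\mathcal V((x_n))=(x_n/\sum_j x_j)_n$ for summable sequences. A random mass-partition is a random counting measure whose points sum up to $1$, and its distribution is its law on the space of counting measures with the $\sigma$-algebra generated by the evaluations $m\mapsto m(B)$. Write $\mathrm{PPP}(\mu)$ for a Poisson point process with intensity $\mu$. **Poisson-Dirichlet distributions.** Let $\alpha\in[0,1)$ and $\theta>-\alpha$. * $\mathrm{PD}(0,\theta)$ is the distribution of $\mathcal V\big(\sum_{T_i\le\theta}\delta_{P_i}\big)$, where $\sum_i\delta_{(T_i,P_i)}\sim\mathrm{PPP}(\mathrm{Leb}\times\gamma)$ on $(0,\infty)^2$ with $\gamma(dt)=t^{-1}e^{-t}\,dt$. * For $\alpha\in(0,1)$, let $\sum_i\delta_{(T_i,P_i,E_i)}\sim\mathrm{PPP}(\mathrm{Leb}\times\mu_\alpha\times\nu_E)$ on $(0,\infty)^3$, where $\mu_\alpha(du)=\frac{\alpha}{\Gamma(1-\alpha)}u^{-\alpha-1}\,du$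 and $\nu_E$ is the standard exponential law, and let $Z_1=\min\{E_i/P_i: T_i\le 1\}$. $\mathrm{PD}(\alpha,\theta)$ is the distribution of $\mathcal V\big(\sum_{T_i\le1}\delta_{P_i}\big)$ under the probability measure whose density with respect to the original one is $Z_1^{\theta}/\Gamma(\theta/\alpha+1)$. **Residual allocation models.** For $\alpha\ge0$, $a_1>0$, $c>0$, let $G_n\sim\mathrm{gamma}(c,1)$ and $U_n\sim\mathrm{beta}(a_1+(n-1)\alpha,\,c+\alpha)$, $n\ge1$, be all independent, and let $\Pi_n=\prod_{l=1}^{n-1}U_l$. $\mathrm{RAM}(\alpha,a_1,c)$ is the distribution of $\sum_n\delta_{V_n}$ with $(V_n)=\mathcal V(G_n\Pi_n)$, where $\sum_n G_n\Pi_n<\infty$ almost surely. **Corollary 2.4** (McCloskey, Perman, Pitman, Yor). Let $\alpha\in[0,1)$ and $\theta+\alpha>0$. Then $\mathrm{PD}(\alpha,\theta)$ exists (that is, the processes in its definition exist) and: 1. There is a sequence of independent random variables $\tilde Y_n\sim\mathrm{beta}(1-\alpha,\,n\alpha+\theta)$, $n\ge1$, such that, with $$\tilde V_1=\tilde Y_1,\qquad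 \tilde V_n=(1-\tilde Y_1)\cdots(1-\tilde Y_{n-1})\tilde Y_n,\quad n\ge2,$$ one has $\sum_n\tilde V_n=1$ almost surely and $\sum_n\delta_{\tilde V_n}$ has the $\mathrm{PD}(\alpha,\theta)$ distribution. 2. $\mathrm{PD}(\alpha,\theta)$ is the $\mathrm{RAM}(\alpha,\alpha+\theta,1-\alpha)$ distribution. -/

import Mathlib

open MeasureTheory ProbabilityTheory Filter Set
open scoped ENNReal NNReal Topology

noncomputable section

namespace MassPartition

/-- The counting measure `∑ₙ δ_{v n}` on the real line. Random counting measures are random elements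
of `Measure ℝ`, whose measurable structure is generated by the evaluations `m ↦ m B`. -/
def pointMeasure (v : ℕ → ℝ) : Measure ℝ :=
  Measure.sum fun n => Measure.dirac (v n)

/-- Self-normalization of a counting measure with finite sum of points:
`∑ᵢ δ_{xᵢ} ↦ ∑ᵢ δ_{xᵢ / ∑ⱼ xⱼ}`. -/
def selfNormalize (m : Measure ℝ) : Measure ℝ :=
  m.map fun x => x / ∫ y, y ∂m

/-- Self-normalization of a summable sequence: `(xₙ) ↦ (xₙ / ∑ⱼ xⱼ)`. -/
def normalizeSeq (x : ℕ → ℝ) : ℕ → ℝ :=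
  fun n => x n / ∑' j, x j

/-- `N` is, under the probability measure `P`, a Poisson point process with intensity `μ`:
a random counting measure such that `N B` is Poisson distributed with mean `μ B` for measurable `B`
(being a.s. infinite if `μ B = ∞`), with independent values on disjoint measurable sets. -/
structure IsPoissonProcess {Ω X : Type} [MeasurableSpace Ω] [MeasurableSpace X]
    (N : Ω → Measure X) (μ : Measure X) (P : Measure Ω) : Prop where
  isProbabilityMeasure : IsProbabilityMeasure P
  measurable : Measurable N
  counting : ∀ᵐ ω ∂P, ∃ (ι : Type) (_ : Countable ι) (x : ι → X),
    N ω = Measure.sum fun i => Measure.dirac (x i)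
  law : ∀ B : Set X, MeasurableSet B → μ B ≠ ∞ →
    HasLaw (fun ω => N ω B) ((poissonMeasure (μ B).toNNReal).map (fun k : ℕ => (k : ℝ≥0∞))) P
  law_top : ∀ B : Set X, MeasurableSet B → μ B = ∞ → ∀ᵐ ω ∂P, N ω B = ∞
  indep : ∀ (n : ℕ) (B : Fin n → Set X), (∀ i, MeasurableSet (B i)) →
    Pairwise (fun i j => Disjoint (B i) (B j)) → iIndepFun (fun i ω => N ω (B i)) P

/-- Lebesgue measure on the time half-line `(0, ∞)`. -/
def timeMeasure : Measure ℝ := volume.restrict (Ioi 0)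

/-- The Lévy measure `t⁻¹ e⁻ᵗ dt` on `(0, ∞)` of the gamma subordinator. -/
def gammaLevy : Measure ℝ :=
  (volume.restrict (Ioi 0)).withDensity fun x => ENNReal.ofReal (x⁻¹ * Real.exp (-x))

/-- The Lévy measure `α / Γ(1 - α) u^{-(α+1)} du` on `(0, ∞)` of the `α`-stable subordinator. -/
def stableLevy (α : ℝ) : Measure ℝ :=
  (volume.restrict (Ioi 0)).withDensity fun u =>
    ENNReal.ofReal (α / Real.Gamma (1 - α) * u ^ (-(α + 1)))

/-- For `N = ∑ᵢ δ_{(Tᵢ, Pᵢ)}`, the counting measure `∑_{Tᵢ ≤ s} δ_{Pᵢ}` of the jumps up to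
time `s`. -/
def jumps (s : ℝ) (N : Measure (ℝ × ℝ)) : Measure ℝ :=
  (N.restrict {q | q.1 ≤ s}).map fun q => q.2

/-- For `M = ∑ᵢ δ_{(Tᵢ, Pᵢ, Eᵢ)}`, the counting measure `∑_{Tᵢ ≤ 1} δ_{(Eᵢ / Pᵢ, Pᵢ)}`. -/
def sizeBiasMarks (M : Measure (ℝ × ℝ × ℝ)) : Measure (ℝ × ℝ) :=
  (M.restrict {q | q.1 ≤ 1}).map fun q => (q.2.2 / q.2.1, q.2.1)

/-- The smallest first coordinate among the points of a counting measure on `(0, ∞)²`. -/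
def firstMark (m : Measure (ℝ × ℝ)) : ℝ :=
  sInf {z : ℝ | m {q | q.1 ≤ z} ≠ 0}

/-- `ν` is the Poisson-Dirichlet distribution `PD(0, θ)`: the law of the normalized jumps up to time
`θ` of a gamma subordinator. -/
def IsPoissonDirichletZero (θ : ℝ) (ν : Measure (Measure ℝ)) : Prop :=
  ∃ (Ω : Type) (_ : MeasurableSpace Ω) (P : Measure Ω) (N : Ω → Measure (ℝ × ℝ)),
    IsPoissonProcess N (timeMeasure.prod gammaLevy) P ∧
    HasLaw (fun ω => selfNormalize (jumps θ (N ω))) ν P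

/-- `ν` is the Poisson-Dirichlet distribution `PD(α, θ)`, `0 < α < 1`, `θ > -α`: the law of the
normalized jumps `Pᵢ` up to time `1` of an `α`-stable subordinator with i.i.d. standard exponential
marks `Eᵢ`, after changing the underlying probability by the density `Z₁^θ / Γ(θ/α + 1)`, where
`Z₁ = min {Eᵢ / Pᵢ : Tᵢ ≤ 1}`. -/
def IsPoissonDirichletPos (α θ : ℝ) (ν : Measure (Measure ℝ)) : Prop :=
  ∃ (Ω : Type) (_ : MeasurableSpace Ω) (P : Measure Ω) (M : Ω → Measure (ℝ × ℝ × ℝ)),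
    IsPoissonProcess M (timeMeasure.prod ((stableLevy α).prod (expMeasure 1))) P ∧
    HasLaw (fun ω => selfNormalize ((sizeBiasMarks (M ω)).map Prod.snd)) ν
      (P.withDensity fun ω =>
        ENNReal.ofReal (firstMark (sizeBiasMarks (M ω)) ^ θ / Real.Gamma (θ / α + 1)))

/-- `ν` is the Poisson-Dirichlet distribution `PD(α, θ)`, `0 ≤ α < 1`, `θ > -α`, as a law on
counting measures. -/
def IsPoissonDirichlet (α θ : ℝ) (ν : Measure (Measure ℝ)) : Prop :=
  (α = 0 ∧ IsPoissonDirichletZero θ ν) ∨ (α ≠ 0 ∧ IsPoissonDirichletPos α θ ν)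

/-- The stick-breaking sequence `Vₙ = (1 - Y₀) ⋯ (1 - Yₙ₋₁) Yₙ` (indexed from `0`). -/
def stickBreaking (y : ℕ → ℝ) : ℕ → ℝ :=
  fun n => (∏ i ∈ Finset.range n, (1 - y i)) * y n

/-- `ν` is the law of `∑ₙ δ_{Vₙ}` where `(Vₙ)` is obtained by stick-breaking from independent
`Yₙ ∼ beta(a n, b n)`, and sums up to one almost surely. -/
def HasBetaStickBreaking (a b : ℕ → ℝ) (ν : Measure (Measure ℝ)) : Prop :=
  ∃ (Ω : Type) (_ : MeasurableSpace Ω) (P : Measure Ω) (_ : IsProbabilityMeasure P)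
    (Y : ℕ → Ω → ℝ),
    iIndepFun Y P ∧
    (∀ n, HasLaw (Y n) (betaMeasure (a n) (b n)) P) ∧
    (∀ᵐ ω ∂P, HasSum (stickBreaking fun n => Y n ω) 1) ∧
    HasLaw (fun ω => pointMeasure (stickBreaking fun n => Y n ω)) ν P

/-- The weighted sequence `Gₙ Πₙ` with `Πₙ = U₀ ⋯ Uₙ₋₁` (indexed from `0`). -/
def perpetuityTerms (g u : ℕ → ℝ) : ℕ → ℝ :=
  fun n => g n * ∏ i ∈ Finset.range n, u i

/-- `ν` is the residual allocation model `RAM(α, a₁, c)`, `α ≥ 0`, `a₁ > 0`, `c > 0`: the law of the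
mass-partition obtained by self-normalization of `(Gₙ Πₙ)`, where `Gₙ ∼ gamma(c, 1)` and
`Uₙ ∼ beta(a₁ + n α, c + α)`, `n ≥ 0`, are all independent. -/
def IsRAM (α a₁ c : ℝ) (ν : Measure (Measure ℝ)) : Prop :=
  ∃ (Ω : Type) (_ : MeasurableSpace Ω) (P : Measure Ω) (_ : IsProbabilityMeasure P)
    (G U : ℕ → Ω → ℝ),
    iIndepFun (Sum.elim G U) P ∧
    (∀ n, HasLaw (G n) (gammaMeasure c 1) P) ∧
    (∀ n : ℕ, HasLaw (U n) (betaMeasure (a₁ + n * α) (c + α)) P) ∧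
    (∀ᵐ ω ∂P, Summable (perpetuityTerms (fun n => G n ω) fun n => U n ω)) ∧
    HasLaw (fun ω =>
      pointMeasure (normalizeSeq (perpetuityTerms (fun n => G n ω) fun n => U n ω))) ν P

end MassPartition

end

/-!
The Poisson-Dirichlet distribution and the stick-breaking distribution are both identified with
the law of one functional, `ramPartition`, of the independent sequence `(Gₙ, Uₙ)` that defines the
residual allocation model: `isPoissonDirichlet_iff`, `isRAM_ramLaw`, `hasBetaStickBreaking_ramLaw`.

**Reduction to explicit Poisson processes.** The law of a Poisson process is determined by its
intensity (`IsPoissonProcess.map_eq`), and the law of the normalized jumps is a function of it, so any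
process with the right intensity may be used. A convenient one comes from a unit-rate Poisson process
`Γ₀ < Γ₁ < ⋯` with independent marks `Gₙ` (`isPoissonProcess_markedPoint`), mapped to

* `Gₙ e^{-Γₙ/θ}` with `Gₙ ∼ gamma(1)` for the gamma subordinator (`map_exp_mul_eq_gammaLevy`);
* `(Γₙ^{1/α}, Gₙ Γₙ^{-1/α})` with `Gₙ ∼ gamma(1 - α)` for the pairs `(Eᵢ/Pᵢ, Pᵢ)` attached to the
  stable subordinator (`map_sizeBias_stableLevy`): the jumps are listed in size-biased order.

Up to a random factor, which the normalization removes, the points are `Gₙ U₀ ⋯ Uₙ₋₁`, with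
`Uₙ = e^{-(Γₙ₊₁ - Γₙ)/θ}` in the first case and `Uₙ = (Γₙ/Γₙ₊₁)^{1/α}` in the second. There the first
mark is `Z₁ = Γ₀^{1/α}`, so the change of probability only turns the exponential variable `Γ₀` into a
`gamma(θ/α + 1)` variable, and the ratios `Γₙ/Γₙ₊₁` are then independent beta variables.

**Stick-breaking.** In the recursion `Sₙ₊₁ = (1 - Yₙ) Sₙ + Xₙ`, started from a gamma variable and with
`Yₙ` beta and `Xₙ` gamma, the beta-gamma algebra (`measurePreserving_stick`) shows that
`Gₙ = Yₙ Sₙ` and `Uₙ = (1 - Yₙ) Sₙ / Sₙ₊₁` are all independent with the laws of the residual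
allocation model, while `Gₙ U₀ ⋯ Uₙ₋₁ = S₀ (1 - Y₀) ⋯ (1 - Yₙ₋₁) Yₙ` telescopes
(`perpetuityTerms_eq_stickBreaking`). This gives the stick-breaking representation and the
summability of the terms at once.

Both independence statements are instances of `map_outputs_eq_infinitePi`: a recursion whose every
step maps a product law to a product law has independent outputs.
-/

noncomputable section

namespace MassPartition

/-! ### Poisson point processes: transformations and uniqueness in law -/

/-- The atoms of the algebra of sets generated by the family `B`. -/
def atom {X ι : Type*} (B : ι → Set X) (J : ι → Bool) : Set X :=
  {x | ∀ j, x ∈ B j ↔ J j = true}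

lemma pairwise_disjoint_atom {X ι : Type*} (B : ι → Set X) :
    Pairwise (fun J K => Disjoint (atom B J) (atom B K)) := by
  intro J K hJK
  refine Set.disjoint_left.2 fun x hx hx' => hJK ?_
  ext j
  exact Bool.eq_iff_iff.2 ((hx j).symm.trans (hx' j)) ▸ rfl

section PoissonProcess

variable {Ω Ω' X Y : Type} [MeasurableSpace Ω] [MeasurableSpace Ω'] [MeasurableSpace X]
  [MeasurableSpace Y]

/-- The Poisson distribution with parameter `l ∈ [0, ∞]` as a law on `[0, ∞]`; the parameter `∞`
gives the Dirac mass at `∞`. -/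
def poissonLaw (l : ℝ≥0∞) : Measure ℝ≥0∞ :=
  if l = ∞ then Measure.dirac ∞ else (poissonMeasure l.toNNReal).map (fun k : ℕ => (k : ℝ≥0∞))

instance (l : ℝ≥0∞) : IsProbabilityMeasure (poissonLaw l) := by
  unfold poissonLaw
  split_ifs
  · infer_instance
  · exact Measure.isProbabilityMeasure_map (by fun_prop)

lemma IsPoissonProcess.hasLaw {N : Ω → Measure X} {μ : Measure X} {P : Measure Ω}
    (h : IsPoissonProcess N μ P) {B : Set X} (hB : MeasurableSet B) :
    HasLaw (fun ω => N ω B) (poissonLaw (μ B)) P := by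
  have := h.isProbabilityMeasure
  by_cases hμ : μ B = ∞
  · have h1 := h.law_top B hB hμ
    refine HasLaw.congr (X := fun _ => ∞) ⟨by fun_prop, ?_⟩ h1
    simp [poissonLaw, hμ]
  · simpa [poissonLaw, hμ] using h.law B hB hμ

lemma IsPoissonProcess.map {N : Ω → Measure X} {μ : Measure X} {P : Measure Ω}
    (h : IsPoissonProcess N μ P) {f : X → Y} (hf : Measurable f) :
    IsPoissonProcess (fun ω => (N ω).map f) (μ.map f) P where
  isProbabilityMeasure := h.isProbabilityMeasure
  measurable := (Measure.measurable_map f hf).comp h.measurable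
  counting := by
    filter_upwards [h.counting] with ω ⟨ι, hι, x, hx⟩
    refine ⟨ι, hι, fun i => f (x i), ?_⟩
    rw [hx, Measure.map_sum hf.aemeasurable]
    simp_rw [Measure.map_dirac' hf]
  law B hB hμ := by
    simp only [Measure.map_apply hf hB] at hμ ⊢
    exact h.law _ (hf hB) hμ
  law_top B hB hμ := by
    simp only [Measure.map_apply hf hB] at hμ ⊢
    exact h.law_top _ (hf hB) hμ
  indep n B hB hd := by
    have e : (fun i ω => (N ω).map f (B i)) = fun i ω => N ω (f ⁻¹' B i) :=
      funext fun i => funext fun ω => Measure.map_apply hf (hB i)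
    rw [e]
    exact h.indep n _ (fun i => hf (hB i)) fun i j hij => (hd hij).preimage f

lemma IsPoissonProcess.restrict {N : Ω → Measure X} {μ : Measure X} {P : Measure Ω}
    (h : IsPoissonProcess N μ P) {A : Set X} (hA : MeasurableSet A) :
    IsPoissonProcess (fun ω => (N ω).restrict A) (μ.restrict A) P where
  isProbabilityMeasure := h.isProbabilityMeasure
  measurable := by
    refine Measure.measurable_of_measurable_coe _ fun s hs => ?_
    simp only [Measure.restrict_apply hs]
    exact (Measure.measurable_coe (hs.inter hA)).comp h.measurable
  counting := by
    classical
    filter_upwards [h.counting] with ω ⟨ι, hι, x, hx⟩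
    refine ⟨{i // x i ∈ A}, inferInstance, fun i => x i, ?_⟩
    rw [hx, Measure.restrict_sum _ hA]
    ext s hs
    have hne : ∀ i, x i ∉ A → (Measure.dirac (x i)).restrict A s = 0 := fun i hi => by
      rw [Measure.restrict_apply hs, Measure.dirac_apply' _ (hs.inter hA)]
      simp [hi]
    simp only [Measure.sum_apply _ hs]
    rw [← tsum_subtype_eq_of_support_subset (s := {i | x i ∈ A})]
    · refine tsum_congr fun i => ?_
      have hi : x i.1 ∈ A := i.2
      rw [Measure.restrict_apply hs, Measure.dirac_apply' _ (hs.inter hA), Measure.dirac_apply' _ hs]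
      by_cases h : x i.1 ∈ s <;> simp [h, hi]
    · exact fun i hi => by_contra fun hiA => hi (hne i hiA)
  law B hB hμ := by
    simp only [Measure.restrict_apply hB] at hμ ⊢
    exact h.law _ (hB.inter hA) hμ
  law_top B hB hμ := by
    simp only [Measure.restrict_apply hB] at hμ ⊢
    exact h.law_top _ (hB.inter hA) hμ
  indep n B hB hd := by
    have e : (fun i ω => (N ω).restrict A (B i)) = fun i ω => N ω (B i ∩ A) :=
      funext fun i => funext fun ω => Measure.restrict_apply (hB i)
    rw [e]
    exact h.indep n _ (fun i => (hB i).inter hA) fun i j hij =>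
      (hd hij).mono inter_subset_left inter_subset_left

/-- The joint law of the values of a Poisson process on finitely many disjoint sets. -/
lemma IsPoissonProcess.map_pi {N : Ω → Measure X} {μ : Measure X} {P : Measure Ω}
    (h : IsPoissonProcess N μ P) {ι : Type*} [Fintype ι] (B : ι → Set X)
    (hB : ∀ i, MeasurableSet (B i)) (hd : Pairwise (fun i j => Disjoint (B i) (B j))) :
    P.map (fun ω i => N ω (B i)) = Measure.pi fun i => poissonLaw (μ (B i)) := by
  have := h.isProbabilityMeasure
  let e := Fintype.equivFin ι
  have h1 := h.indep _ (fun i => B (e.symm i)) (fun i => hB _)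
    fun i j hij => hd (e.symm.injective.ne hij)
  have h2 : iIndepFun (fun i ω => N ω (B i)) P := by
    simpa using h1.precomp e.injective
  rw [(iIndepFun_iff_map_fun_eq_pi_map fun i => (h.hasLaw (hB i)).aemeasurable).1 h2]
  simp_rw [fun i => (h.hasLaw (hB i)).map_eq]

lemma measurableSet_atom {ι : Type*} [Countable ι] {B : ι → Set X} (hB : ∀ i, MeasurableSet (B i))
    (J : ι → Bool) : MeasurableSet (atom B J) := by
  rw [show atom B J = ⋂ j, {x | x ∈ B j ↔ J j = true} by ext; simp [atom]]
  refine MeasurableSet.iInter fun j => ?_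
  cases hj : J j
  · rw [show {x | x ∈ B j ↔ false = true} = (B j)ᶜ by ext; simp]
    exact (hB j).compl
  · rw [show {x | x ∈ B j ↔ true = true} = B j by ext; simp]
    exact hB j

lemma measure_eq_sum_atom {ι : Type*} [Fintype ι] [DecidableEq ι] (m : Measure X) (B : ι → Set X)
    (hB : ∀ i, MeasurableSet (B i)) (i : ι) :
    m (B i) = ∑ J : ι → Bool, if J i then m (atom B J) else 0 := by
  classical
  rw [← Finset.sum_filter, ← measure_biUnion_finset _ fun J _ => measurableSet_atom hB J]
  · congr 1
    ext x
    simp only [Finset.mem_filter, Finset.mem_univ, true_and, mem_iUnion, exists_prop]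
    constructor
    · exact fun hx => ⟨fun j => decide (x ∈ B j), by simpa using hx, fun j => by simp⟩
    · rintro ⟨J, hJ, hx⟩
      exact (hx i).2 hJ
  · exact fun J _ K _ hJK => pairwise_disjoint_atom B hJK

/-- Two random measures with the same joint laws on finite families of measurable sets have the
same law. -/
lemma map_eq_of_forall_finset {N : Ω → Measure X} {N' : Ω' → Measure X} {P : Measure Ω}
    {P' : Measure Ω'} [IsFiniteMeasure P] (hN : Measurable N) (hN' : Measurable N')
    (h : ∀ I : Finset {B : Set X // MeasurableSet B},
      P.map (fun ω (i : I) => N ω i.1.1) = P'.map (fun ω (i : I) => N' ω i.1.1)) :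
    P.map N = P'.map N' := by
  let Φ : Measure X → ({B : Set X // MeasurableSet B} → ℝ≥0∞) := fun m B => m B.1
  have hΦ : Measurable Φ := measurable_pi_lambda _ fun B => Measure.measurable_coe B.2
  -- the `σ`-algebra on measures is the one induced by `Φ`
  have hcomap : ∀ A : Set (Measure X), MeasurableSet A →
      ∃ A', MeasurableSet A' ∧ Φ ⁻¹' A' = A := by
    intro A hA
    have hle : (Measure.instMeasurableSpace : MeasurableSpace (Measure X)) ≤
        MeasurableSpace.comap Φ MeasurableSpace.pi := by
      refine iSup₂_le fun s hs => ?_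
      rw [show (fun μ : Measure X => μ s) = (fun z => z ⟨s, hs⟩) ∘ Φ from rfl,
        ← MeasurableSpace.comap_comp]
      refine MeasurableSpace.comap_mono ?_
      rw [← measurable_iff_comap_le, ← BorelSpace.measurable_eq (α := ℝ≥0∞)]
      exact measurable_pi_apply _
    exact hle A hA
  have key : P.map (fun ω => Φ (N ω)) = P'.map (fun ω => Φ (N' ω)) := by
    refine IsProjectiveLimit.unique
      (P := fun I => P.map (fun ω (i : I) => N ω i.1.1)) (fun I => ?_) (fun I => ?_)
    · exact Measure.map_map (Finset.measurable_restrict I) (hΦ.comp hN)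
    · exact (Measure.map_map (Finset.measurable_restrict I) (hΦ.comp hN')).trans (h I).symm
  ext A hA
  obtain ⟨A', hA', rfl⟩ := hcomap A hA
  rw [Measure.map_apply hN hA, Measure.map_apply hN' hA]
  exact (Measure.map_apply (hΦ.comp hN) hA').symm.trans
    ((congrArg (fun m => m A') key).trans (Measure.map_apply (hΦ.comp hN') hA'))

/-- The law of a Poisson process is determined by its intensity. -/
theorem IsPoissonProcess.map_eq {N : Ω → Measure X} {N' : Ω' → Measure X} {μ : Measure X}
    {P : Measure Ω} {P' : Measure Ω'} (h : IsPoissonProcess N μ P)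
    (h' : IsPoissonProcess N' μ P') : P.map N = P'.map N' := by
  classical
  have := h.isProbabilityMeasure
  refine map_eq_of_forall_finset h.measurable h'.measurable fun I => ?_
  let B : I → Set X := fun i => i.1.1
  have hB : ∀ i, MeasurableSet (B i) := fun i => i.1.2
  -- the values on the sets `B i` are sums of the values on the atoms, which are disjoint
  let S : ((I → Bool) → ℝ≥0∞) → (I → ℝ≥0∞) := fun z i => ∑ J, if J i then z J else 0
  have hS : Measurable S := by
    refine measurable_pi_lambda _ fun i => Finset.measurable_sum _ fun J _ => ?_
    by_cases hJ : J i
    · simpa [hJ] using measurable_pi_apply J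
    · simp [hJ]
  have hm : ∀ {Ω₀ : Type} [MeasurableSpace Ω₀] {N₀ : Ω₀ → Measure X}, Measurable N₀ →
      Measurable (fun ω J => N₀ ω (atom B J)) := fun {Ω₀ _ N₀} hN₀ =>
    measurable_pi_lambda _ fun J => (Measure.measurable_coe (measurableSet_atom hB J)).comp hN₀
  have e : ∀ {Ω₀ : Type} {N₀ : Ω₀ → Measure X}, (fun ω (i : I) => N₀ ω i.1.1) =
      S ∘ fun ω J => N₀ ω (atom B J) := fun {Ω₀ N₀} =>
    funext fun ω => funext fun i => measure_eq_sum_atom (N₀ ω) B hB i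
  rw [e, e, ← Measure.map_map hS (hm h.measurable),
    ← Measure.map_map hS (hm h'.measurable),
    h.map_pi _ (measurableSet_atom hB) (pairwise_disjoint_atom B),
    h'.map_pi _ (measurableSet_atom hB) (pairwise_disjoint_atom B)]

end PoissonProcess

/-! ### The Laplace functional criterion for Poisson processes -/

/-- The function `x ↦ e^{-x}` on `[0, ∞]`. -/
def expNeg (x : ℝ≥0∞) : ℝ≥0∞ := EReal.exp (-(x : EReal))

@[simp] lemma expNeg_zero : expNeg 0 = 1 := by simp [expNeg]

@[simp] lemma expNeg_top : expNeg ∞ = 0 := by simp [expNeg]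

lemma expNeg_le_one (x : ℝ≥0∞) : expNeg x ≤ 1 := by
  simp [expNeg, EReal.coe_ennreal_nonneg]

lemma expNeg_ne_top (x : ℝ≥0∞) : expNeg x ≠ ∞ :=
  ((expNeg_le_one x).trans_lt ENNReal.one_lt_top).ne

lemma expNeg_add (x y : ℝ≥0∞) : expNeg (x + y) = expNeg x * expNeg y := by
  rw [expNeg, expNeg, expNeg, EReal.exp_neg, EReal.exp_neg, EReal.exp_neg, EReal.coe_ennreal_add,
    EReal.exp_add, ENNReal.mul_inv]
  · left
    simp only [ne_eq, EReal.exp_eq_zero_iff]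
    exact EReal.coe_ennreal_ne_bot x
  · right
    simp only [ne_eq, EReal.exp_eq_zero_iff]
    exact EReal.coe_ennreal_ne_bot y

lemma expNeg_ofReal {x : ℝ} (hx : 0 ≤ x) :
    expNeg (ENNReal.ofReal x) = ENNReal.ofReal (Real.exp (-x)) := by
  rw [expNeg, EReal.coe_ennreal_ofReal, max_eq_left hx, ← EReal.coe_neg, EReal.exp_coe]

lemma continuous_expNeg : Continuous expNeg :=
  ENNReal.continuous_exp.comp (continuous_neg.comp continuous_coe_ennreal_ereal)

@[fun_prop]
lemma measurable_expNeg : Measurable expNeg := continuous_expNeg.measurable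

lemma expNeg_sum {ι : Type*} (s : Finset ι) (f : ι → ℝ≥0∞) :
    expNeg (∑ i ∈ s, f i) = ∏ i ∈ s, expNeg (f i) := by
  classical
  induction s using Finset.induction_on with
  | empty => simp
  | insert i s hi ih => rw [Finset.sum_insert hi, Finset.prod_insert hi, expNeg_add, ih]

lemma expNeg_nsmul (n : ℕ) (x : ℝ≥0∞) : expNeg (n * x) = expNeg x ^ n := by
  simpa using expNeg_sum (Finset.range n) (fun _ => x)

lemma expNeg_antitone : Antitone expNeg := fun x y hxy => by
  simpa [expNeg] using hxy

/-- The left inverse `y ↦ -log y` of `expNeg`. -/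
def negLog (y : ℝ≥0∞) : ℝ≥0∞ := (-(ENNReal.log y)).toENNReal

@[fun_prop]
lemma measurable_negLog : Measurable negLog := by
  unfold negLog
  fun_prop

@[simp] lemma negLog_expNeg (x : ℝ≥0∞) : negLog (expNeg x) = x := by
  simp [negLog, expNeg]

/-- Two probability measures on a finite-dimensional cube with the same moments are equal, by the
Stone-Weierstrass theorem. -/
theorem ext_of_moments {ι : Type*} [Fintype ι] {μ ν : Measure (ι → unitInterval)}
    [IsProbabilityMeasure μ] [IsProbabilityMeasure ν]
    (h : ∀ m : ι → ℕ, ∫ x, ∏ i, (x i : ℝ) ^ m i ∂μ = ∫ x, ∏ i, (x i : ℝ) ^ m i ∂ν) : μ = ν := by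
  classical
  let c : ι → BoundedContinuousFunction (ι → unitInterval) ℝ := fun i =>
    BoundedContinuousFunction.mkOfCompact ⟨fun x => (x i : ℝ), by fun_prop⟩
  let A : StarSubalgebra ℝ (BoundedContinuousFunction (ι → unitInterval) ℝ) :=
    { Algebra.adjoin ℝ (range c) with
      star_mem' := fun {a} ha => by
        have : star a = a := by ext; simp
        rwa [this] }
  have hmon : ∀ g ∈ Submonoid.closure (range c), ∃ m : ι → ℕ, ∀ x, g x = ∏ i, (x i : ℝ) ^ m i := by
    intro g hg
    induction hg using Submonoid.closure_induction with
    | mem g hg =>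
      obtain ⟨i, rfl⟩ := hg
      refine ⟨fun j => if j = i then 1 else 0, fun x => ?_⟩
      simp [c, Finset.prod_ite_eq', pow_ite]
    | one => exact ⟨0, fun x => by simp⟩
    | mul f g _ _ hf hg =>
      obtain ⟨m, hm⟩ := hf
      obtain ⟨m', hm'⟩ := hg
      exact ⟨m + m', fun x => by simp [hm, hm', pow_add, Finset.prod_mul_distrib]⟩
  refine ext_of_forall_mem_subalgebra_integral_eq_of_polish (A := A) ?_ ?_
  · intro x y hxy
    obtain ⟨i, hi⟩ := Function.ne_iff.1 hxy
    refine ⟨c i, ⟨_, ⟨c i, Algebra.subset_adjoin ⟨i, rfl⟩, rfl⟩, rfl⟩, ?_⟩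
    simpa [c] using Subtype.coe_ne_coe.2 hi
  · have hspan : ∀ g ∈ Submodule.span ℝ (Submonoid.closure (range c) :
        Set (BoundedContinuousFunction (ι → unitInterval) ℝ)), ∫ x, g x ∂μ = ∫ x, g x ∂ν := by
      intro g hg
      induction hg using Submodule.span_induction with
      | mem g hg =>
        obtain ⟨m, hm⟩ := hmon g hg
        simp only [hm, h m]
      | zero => simp
      | add f g hf hg ihf ihg =>
        simp only [BoundedContinuousFunction.coe_add, Pi.add_apply]
        rw [integral_add (f.integrable _) (g.integrable _),
          integral_add (f.integrable _) (g.integrable _), ihf, ihg]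
      | smul a f hf ihf =>
        simp only [BoundedContinuousFunction.coe_smul, smul_eq_mul]
        rw [integral_const_mul, integral_const_mul, ihf]
    intro g hg
    refine hspan g ?_
    rw [← Algebra.adjoin_eq_span]
    exact hg

/-- Two laws on `[0, ∞]^ι` with the same Laplace transform at integer points are equal: their
images under `x ↦ e^{-x}` have the same moments. -/
theorem ext_of_laplace {ι : Type*} [Fintype ι] {μ ν : Measure (ι → ℝ≥0∞)}
    [IsProbabilityMeasure μ] [IsProbabilityMeasure ν]
    (h : ∀ m : ι → ℕ, ∫⁻ x, ∏ i, expNeg (x i) ^ m i ∂μ = ∫⁻ x, ∏ i, expNeg (x i) ^ m i ∂ν) :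
    μ = ν := by
  let F : (ι → ℝ≥0∞) → (ι → unitInterval) := fun x i =>
    ⟨(expNeg (x i)).toReal, ENNReal.toReal_nonneg,
      ENNReal.toReal_le_of_le_ofReal zero_le_one (by simpa using expNeg_le_one (x i))⟩
  let R : (ι → unitInterval) → (ι → ℝ≥0∞) := fun y i => negLog (ENNReal.ofReal (y i))
  have hF : Measurable F := measurable_pi_lambda _ fun i => Measurable.subtype_mk (by fun_prop)
  have hR : Measurable R := by fun_prop
  have hRF : R ∘ F = id := by
    funext x i
    simp [R, F, expNeg_ne_top]
  have key : μ.map F = ν.map F := by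
    have := Measure.isProbabilityMeasure_map (μ := μ) hF.aemeasurable
    have := Measure.isProbabilityMeasure_map (μ := ν) hF.aemeasurable
    have e : ∀ (ρ : Measure (ι → ℝ≥0∞)) (m : ι → ℕ), ∫ x, ∏ i, (x i : ℝ) ^ m i ∂(ρ.map F) =
        (∫⁻ x, ∏ i, expNeg (x i) ^ m i ∂ρ).toReal := by
      intro ρ m
      rw [integral_map hF.aemeasurable (Continuous.aestronglyMeasurable (by fun_prop)),
        ← integral_toReal (Measurable.aemeasurable (by fun_prop))]
      · simp [F, ENNReal.toReal_prod]
      · refine ae_of_all _ fun x => ENNReal.prod_lt_top fun i _ => ?_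
        exact ENNReal.pow_lt_top (expNeg_ne_top _).lt_top
    exact ext_of_moments fun m => by rw [e, e, h m]
  have := congrArg (Measure.map R) key
  rwa [Measure.map_map hR hF, Measure.map_map hR hF, hRF, Measure.map_id, Measure.map_id] at this

lemma lintegral_expNeg_pow_poissonLaw (l : ℝ≥0∞) (m : ℕ) :
    ∫⁻ x, expNeg x ^ m ∂(poissonLaw l) =
      expNeg (ENNReal.ofReal (1 - Real.exp (-m)) * l) := by
  by_cases hl : l = ∞
  · rw [poissonLaw, if_pos hl, lintegral_dirac, hl]
    rcases Nat.eq_zero_or_pos m with rfl | hm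
    · simp
    · rw [ENNReal.mul_top, expNeg_top, zero_pow hm.ne']
      simpa using hm.ne'
  · rw [poissonLaw, if_neg hl, lintegral_map (by fun_prop) (by fun_prop), lintegral_countable']
    lift l to ℝ≥0 using hl with r
    have h1 : ∀ k : ℕ, expNeg (k : ℝ≥0∞) ^ m * poissonMeasure (r : ℝ≥0∞).toNNReal {k} =
        ENNReal.ofReal (Real.exp (-r) * ((r * Real.exp (-m)) ^ k / k.factorial)) := by
      intro k
      rw [poissonMeasure_singleton, ← ENNReal.ofReal_natCast, expNeg_ofReal (by positivity),
        ← ENNReal.ofReal_pow (by positivity), ← ENNReal.ofReal_mul (by positivity),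
        ENNReal.toNNReal_coe, ← Real.exp_nat_mul, mul_pow, ← Real.exp_nat_mul]
      congr 1
      rw [show (m : ℝ) * -(k : ℝ) = k * -(m : ℝ) by ring]
      ring
    have h2 := (NormedSpace.expSeries_div_hasSum_exp ((r : ℝ) * Real.exp (-m))).mul_left
      (Real.exp (-r))
    rw [← Real.exp_eq_exp_ℝ] at h2
    simp_rw [h1]
    rw [← ENNReal.ofReal_tsum_of_nonneg (fun k => by positivity) h2.summable, h2.tsum_eq,
      ← ENNReal.ofReal_coe_nnreal, ← ENNReal.ofReal_mul, expNeg_ofReal, ← Real.exp_add]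
    · congr 2
      ring
    · have : Real.exp (-(m : ℝ)) ≤ 1 := Real.exp_le_one_iff.2 (by simp)
      exact mul_nonneg (by linarith) r.2
    · have : Real.exp (-(m : ℝ)) ≤ 1 := Real.exp_le_one_iff.2 (by simp)
      linarith

/-- A random counting measure is a Poisson process as soon as its Laplace functional has the
Poisson form on (integer combinations of indicators of) disjoint sets. -/
theorem isPoissonProcess_of_laplace {Ω X : Type} [MeasurableSpace Ω] [MeasurableSpace X]
    {N : Ω → Measure X} {μ : Measure X} {P : Measure Ω} [IsProbabilityMeasure P]
    (hN : Measurable N)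
    (hc : ∀ᵐ ω ∂P, ∃ (ι : Type) (_ : Countable ι) (x : ι → X),
      N ω = Measure.sum fun i => Measure.dirac (x i))
    (h : ∀ (n : ℕ) (B : Fin n → Set X), (∀ i, MeasurableSet (B i)) →
      Pairwise (fun i j => Disjoint (B i) (B j)) → ∀ m : Fin n → ℕ,
      ∫⁻ ω, ∏ i, expNeg (N ω (B i)) ^ m i ∂P =
        ∏ i, expNeg (ENNReal.ofReal (1 - Real.exp (-m i)) * μ (B i))) :
    IsPoissonProcess N μ P := by
  have hm : ∀ {B : Set X}, MeasurableSet B → Measurable fun ω => N ω B := fun hB =>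
    (Measure.measurable_coe hB).comp hN
  have joint : ∀ (n : ℕ) (B : Fin n → Set X), (∀ i, MeasurableSet (B i)) →
      Pairwise (fun i j => Disjoint (B i) (B j)) →
      P.map (fun ω i => N ω (B i)) = Measure.pi fun i => poissonLaw (μ (B i)) := by
    intro n B hB hd
    have hmeas : Measurable fun ω i => N ω (B i) := measurable_pi_lambda _ fun i => hm (hB i)
    have := Measure.isProbabilityMeasure_map (μ := P) hmeas.aemeasurable
    refine ext_of_laplace fun m => ?_
    have hind : iIndepFun (fun i (z : Fin n → ℝ≥0∞) => expNeg (z i) ^ m i)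
        (Measure.pi fun i => poissonLaw (μ (B i))) :=
      iIndepFun_pi (X := fun i x => expNeg x ^ m i) fun i => Measurable.aemeasurable (by fun_prop)
    rw [lintegral_map (by fun_prop) hmeas, h n B hB hd m,
      lintegral_prod_eq_prod_lintegral_of_indepFun _ _ hind (by fun_prop)]
    refine Finset.prod_congr rfl fun i _ => ?_
    rw [← lintegral_expNeg_pow_poissonLaw, ← (measurePreserving_eval
      (fun i => poissonLaw (μ (B i))) i).map_eq, lintegral_map (by fun_prop) (by fun_prop)]
  have marg : ∀ B : Set X, MeasurableSet B → P.map (fun ω => N ω B) = poissonLaw (μ B) := by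
    intro B hB
    have := congrArg (Measure.map fun z : Fin 1 → ℝ≥0∞ => z 0)
      (joint 1 (fun _ => B) (fun _ => hB) fun i j hij => (hij (Subsingleton.elim i j)).elim)
    rw [Measure.map_map (by fun_prop) (measurable_pi_lambda _ fun i => hm hB),
      (measurePreserving_eval _ 0).map_eq] at this
    exact this
  refine ⟨inferInstance, hN, hc, fun B hB hμ => ⟨(hm hB).aemeasurable, ?_⟩, fun B hB hμ => ?_,
    fun n B hB hd => ?_⟩
  · simp [marg B hB, poissonLaw, hμ]
  · have h1 := marg B hB
    rw [poissonLaw, if_pos hμ] at h1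
    refine ae_of_ae_map (hm hB).aemeasurable (p := fun x => x = ∞) ?_
    rw [h1]
    exact (ae_dirac_iff (measurableSet_singleton _)).2 rfl
  · rw [iIndepFun_iff_map_fun_eq_pi_map fun i => (hm (hB i)).aemeasurable, joint n B hB hd]
    simp_rw [fun i => marg (B i) (hB i)]

/-! ### Recursions driven by independent innovations -/

section Chain

variable {S Ξ O T : Type*} [MeasurableSpace S] [MeasurableSpace Ξ] [MeasurableSpace O]
  [MeasurableSpace T]

/-- The recursion `sₙ₊₁ = φₙ(sₙ, ξₙ)`, as a function of the pair `(s₀, (ξₙ)ₙ)`. -/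
def chain {S Ξ : Type*} (φ : ℕ → S → Ξ → S) : ℕ → S × (ℕ → Ξ) → S
  | 0, ω => ω.1
  | n + 1, ω => φ n (chain φ n ω) (ω.2 n)

/-- The `σ`-algebra of the events that depend on `s₀, ξ₀, …, ξₙ₋₁`. -/
@[reducible]
def pastAlgebra (S Ξ : Type*) [MeasurableSpace S] [MeasurableSpace Ξ] (n : ℕ) :
    MeasurableSpace (S × (ℕ → Ξ)) :=
  MeasurableSpace.comap (fun ω => (ω.1, (Finset.range n).restrict ω.2)) inferInstance

lemma pastAlgebra_le (n : ℕ) : pastAlgebra S Ξ n ≤ (inferInstance : MeasurableSpace _) :=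
  Measurable.comap_le (by fun_prop)

lemma measurable_fst_pastAlgebra (n : ℕ) :
    Measurable[pastAlgebra S Ξ n] (fun ω : S × (ℕ → Ξ) => ω.1) :=
  (comap_measurable (fun ω : S × (ℕ → Ξ) => (ω.1, (Finset.range n).restrict ω.2))).fst

lemma measurable_eval_pastAlgebra {i n : ℕ} (h : i < n) :
    Measurable[pastAlgebra S Ξ n] (fun ω : S × (ℕ → Ξ) => ω.2 i) :=
  ((measurable_pi_apply (⟨i, Finset.mem_range.2 h⟩ : Finset.range n)).comp measurable_snd).comp
    (comap_measurable (fun ω : S × (ℕ → Ξ) => (ω.1, (Finset.range n).restrict ω.2)))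

lemma pastAlgebra_mono {m n : ℕ} (h : m ≤ n) : pastAlgebra S Ξ m ≤ pastAlgebra S Ξ n := by
  have h1 : Measurable[pastAlgebra S Ξ n]
      (fun ω : S × (ℕ → Ξ) => (Finset.range m).restrict ω.2) :=
    @measurable_pi_lambda _ _ _ (_) _ _ fun i =>
      measurable_eval_pastAlgebra ((Finset.mem_range.1 i.2).trans_le h)
  exact ((measurable_fst_pastAlgebra n).prodMk h1).comap_le

lemma measurable_chain_pastAlgebra {φ : ℕ → S → Ξ → S}
    (hφ : ∀ n, Measurable (Function.uncurry (φ n))) (n : ℕ) :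
    Measurable[pastAlgebra S Ξ n] (chain φ n) := by
  induction n with
  | zero => exact measurable_fst_pastAlgebra 0
  | succ n ih =>
    exact (hφ n).comp (Measurable.prodMk (ih.mono (pastAlgebra_mono n.le_succ) le_rfl)
      (measurable_eval_pastAlgebra n.lt_succ_self))

lemma measurable_chain {φ : ℕ → S → Ξ → S} (hφ : ∀ n, Measurable (Function.uncurry (φ n)))
    (n : ℕ) : Measurable (chain φ n) :=
  (measurable_chain_pastAlgebra hφ n).mono (pastAlgebra_le n) le_rfl

variable {σ : Measure S} [IsProbabilityMeasure σ] {lam : ℕ → Measure Ξ}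
  [∀ n, IsProbabilityMeasure (lam n)]

lemma indepFun_restrict_eval (n : ℕ) :
    IndepFun (fun ω : S × (ℕ → Ξ) => (ω.1, (Finset.range n).restrict ω.2)) (fun ω => ω.2 n)
      (σ.prod (Measure.infinitePi lam)) := by
  have h0 : iIndepFun (fun i (x : ℕ → Ξ) => x i) (Measure.infinitePi lam) :=
    iIndepFun_infinitePi (X := fun _ x => x) fun _ => measurable_id
  have h1 : IndepFun (Finset.range n).restrict (fun x : ℕ → Ξ => x n) (Measure.infinitePi lam) :=
    (h0.indepFun_finset (Finset.range n) {n} (by simp) fun i => measurable_pi_apply i).comp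
      measurable_id (measurable_pi_apply (⟨n, by simp⟩ : ({n} : Finset ℕ)))
  have hr : Measurable fun x : ℕ → Ξ => (Finset.range n).restrict x := by fun_prop
  have he : Measurable fun x : ℕ → Ξ => x n := measurable_pi_apply n
  have he' : Measurable fun ω : S × (ℕ → Ξ) => ω.2 n := he.comp measurable_snd
  have hre : Measurable fun ω : S × (ℕ → Ξ) => (ω.1, (Finset.range n).restrict ω.2) := by fun_prop
  rw [indepFun_iff_map_prod_eq_prod_map_map hr.aemeasurable he.aemeasurable,
    Measure.infinitePi_map_eval] at h1
  rw [indepFun_iff_map_prod_eq_prod_map_map hre.aemeasurable he'.aemeasurable]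
  have : IsProbabilityMeasure ((Measure.infinitePi lam).map (Finset.range n).restrict) :=
    Measure.isProbabilityMeasure_map hr.aemeasurable
  have m1 : MeasurePreserving (fun x : ℕ → Ξ => ((Finset.range n).restrict x, x n))
      (Measure.infinitePi lam)
      (((Measure.infinitePi lam).map (Finset.range n).restrict).prod (lam n)) :=
    ⟨hr.prodMk he, h1⟩
  have m2 := ((measurePreserving_prodAssoc σ _ (lam n)).symm).comp
    ((MeasurePreserving.id σ).prod m1)
  have m3 := (MeasurePreserving.id σ).prod
    (⟨hr, rfl⟩ : MeasurePreserving _ (Measure.infinitePi lam) _)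
  have m4 : (σ.prod (Measure.infinitePi lam)).map (fun ω => ω.2 n) = lam n := by
    rw [← Function.comp_def (fun x : ℕ → Ξ => x n) Prod.snd,
      ← Measure.map_map he measurable_snd, Measure.map_snd_prod]
    simp [Measure.infinitePi_map_eval]
  rw [m4]
  exact m2.map_eq.trans (congrArg (fun m => m.prod (lam n)) m3.map_eq.symm)

/-- Integration over the innovation `ξₙ`, the past being frozen. -/
lemma lintegral_step {n : ℕ} {W : S × (ℕ → Ξ) → T} (hW : Measurable[pastAlgebra S Ξ n] W)
    {F : T → Ξ → ℝ≥0∞} (hF : Measurable (Function.uncurry F)) :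
    ∫⁻ ω, F (W ω) (ω.2 n) ∂(σ.prod (Measure.infinitePi lam)) =
      ∫⁻ ω, ∫⁻ x, F (W ω) x ∂(lam n) ∂(σ.prod (Measure.infinitePi lam)) := by
  have hW' : Measurable W := hW.mono (pastAlgebra_le n) le_rfl
  have hind : IndepFun W (fun ω : S × (ℕ → Ξ) => ω.2 n) (σ.prod (Measure.infinitePi lam)) :=
    indep_of_indep_of_le_left (indepFun_restrict_eval n) hW.comap_le
  have hlaw : (σ.prod (Measure.infinitePi lam)).map (fun ω => ω.2 n) = lam n := by
    rw [← Function.comp_def (fun x : ℕ → Ξ => x n) Prod.snd,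
      ← Measure.map_map (by fun_prop) (by fun_prop), Measure.map_snd_prod]
    simp [Measure.infinitePi_map_eval]
  rw [indepFun_iff_map_prod_eq_prod_map_map (by fun_prop) (by fun_prop), hlaw] at hind
  have h1 := lintegral_map (μ := σ.prod (Measure.infinitePi lam)) hF
    (hW'.prodMk ((measurable_pi_apply n).comp measurable_snd))
  simp only [Function.uncurry, Function.comp] at h1
  rw [← h1, hind, lintegral_prod _ (by fun_prop), lintegral_map (by fun_prop) hW']

/-- If the map `(sₙ, ξₙ) ↦ (oₙ, sₙ₊₁)` transports the product law `σₙ ⊗ λₙ` to the product law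
`ρₙ ⊗ σₙ₊₁`, then the outputs `oₙ` of the recursion are independent with laws `ρₙ`. -/
theorem map_outputs_eq_infinitePi {φ : ℕ → S → Ξ → S} {o : ℕ → S → Ξ → O}
    (hφ : ∀ n, Measurable (Function.uncurry (φ n)))
    (ho : ∀ n, Measurable (Function.uncurry (o n))) {sig : ℕ → Measure S}
    [∀ n, IsProbabilityMeasure (sig n)] {rho : ℕ → Measure O} [∀ n, IsProbabilityMeasure (rho n)]
    (h : ∀ n, ((sig n).prod (lam n)).map (fun p => (o n p.1 p.2, φ n p.1 p.2)) =
      (rho n).prod (sig (n + 1))) :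
    ((sig 0).prod (Measure.infinitePi lam)).map (fun ω n => o n (chain φ n ω) (ω.2 n)) =
      Measure.infinitePi rho := by
  have hmo : ∀ n, Measurable fun ω : S × (ℕ → Ξ) => o n (chain φ n ω) (ω.2 n) := fun n =>
    (ho n).comp ((measurable_chain hφ n).prodMk (by fun_prop))
  -- stronger than independence of the outputs: the state `sₙ` is independent of the earlier outputs
  have key : ∀ (t : ℕ → Set O), (∀ i, MeasurableSet (t i)) → ∀ (n : ℕ) (f : S → ℝ≥0∞),
      Measurable f → ∫⁻ ω, (∏ i ∈ Finset.range n, (t i).indicator 1 (o i (chain φ i ω) (ω.2 i))) *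
        f (chain φ n ω) ∂((sig 0).prod (Measure.infinitePi lam)) =
      (∏ i ∈ Finset.range n, rho i (t i)) * ∫⁻ s, f s ∂(sig n) := by
    intro t ht n
    induction n with
    | zero =>
      intro f hf
      simp only [Finset.range_zero, Finset.prod_empty, one_mul, chain]
      rw [← lintegral_map (g := Prod.fst) hf measurable_fst, Measure.map_fst_prod]
      simp
    | succ n ih =>
      intro f hf
      have hp : Measurable[pastAlgebra S Ξ n] fun ω : S × (ℕ → Ξ) =>
          ((∏ i ∈ Finset.range n, (t i).indicator (1 : O → ℝ≥0∞) (o i (chain φ i ω) (ω.2 i))),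
            chain φ n ω) := by
        refine Measurable.prodMk (Finset.measurable_prod _ fun i hi => ?_)
          (measurable_chain_pastAlgebra hφ n)
        have hi := Finset.mem_range.1 hi
        exact (measurable_one.indicator (ht i)).comp ((ho i).comp (Measurable.prodMk
          ((measurable_chain_pastAlgebra hφ i).mono (pastAlgebra_mono hi.le) le_rfl)
          (measurable_eval_pastAlgebra hi)))
      have hF : Measurable (Function.uncurry fun (w : ℝ≥0∞ × S) (x : Ξ) =>
          w.1 * ((t n).indicator 1 (o n w.2 x) * f (φ n w.2 x))) := by
        have h1 : Measurable fun p : (ℝ≥0∞ × S) × Ξ => o n p.1.2 p.2 :=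
          (ho n).comp ((measurable_snd.comp measurable_fst).prodMk measurable_snd)
        have h2 : Measurable fun p : (ℝ≥0∞ × S) × Ξ => φ n p.1.2 p.2 :=
          (hφ n).comp ((measurable_snd.comp measurable_fst).prodMk measurable_snd)
        exact (measurable_fst.comp measurable_fst).mul
          (((measurable_one.indicator (ht n)).comp h1).mul (hf.comp h2))
      have hH : Measurable fun p : S × Ξ => (t n).indicator (1 : O → ℝ≥0∞) (o n p.1 p.2) *
          f (φ n p.1 p.2) :=
        ((measurable_one.indicator (ht n)).comp (ho n)).mul (hf.comp (hφ n))
      have h2 : ∀ (w : ℝ≥0∞) (s : S),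
          ∫⁻ x, w * ((t n).indicator 1 (o n s x) * f (φ n s x)) ∂(lam n) =
            w * ∫⁻ x, (t n).indicator 1 (o n s x) * f (φ n s x) ∂(lam n) := fun w s =>
        lintegral_const_mul _ (hH.comp (measurable_prodMk_left (x := s)))
      have h1 := (lintegral_step (σ := sig 0) (lam := lam) hp hF).trans
        (lintegral_congr fun ω => h2 _ (chain φ n ω))
      simp only [Finset.prod_range_succ, chain, mul_assoc]
      refine h1.trans ?_
      rw [ih _ hH.lintegral_prod_right']
      congr 1
      rw [← lintegral_prod _ hH.aemeasurable]
      have h3 : Measurable fun q : O × S => (t n).indicator (1 : O → ℝ≥0∞) q.1 * f q.2 := by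
        exact ((measurable_one.indicator (ht n)).comp measurable_fst).mul (hf.comp measurable_snd)
      have h4 := lintegral_map (μ := (sig n).prod (lam n)) h3 ((ho n).prodMk (hφ n))
      simp only [Function.uncurry] at h4
      rw [← h4]
      rw [h n, lintegral_prod_mul (measurable_one.indicator (ht n)).aemeasurable hf.aemeasurable]
      simp [ht n]
  refine Measure.eq_infinitePi _ fun s t ht => ?_
  classical
  obtain ⟨n, hn⟩ := s.exists_nat_subset_range
  -- a box over a finite set of indices is extended to an initial segment by trivial factors
  let t' : ℕ → Set O := fun i => if i ∈ s then t i else univ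
  have ht' : ∀ i, MeasurableSet (t' i) := fun i => by
    by_cases hi : i ∈ s <;> simp [t', hi, ht]
  have h1 := key t' ht' n 1 measurable_one
  simp only [Pi.one_apply, mul_one, lintegral_const, measure_univ] at h1
  rw [Measure.map_apply (measurable_pi_lambda _ hmo)
    (MeasurableSet.pi s.countable_toSet fun i _ => ht i)]
  have h2 : ∏ i ∈ Finset.range n, rho i (t' i) = ∏ i ∈ s, rho i (t i) := by
    rw [← Finset.prod_subset hn]
    · exact Finset.prod_congr rfl fun i hi => by simp [t', hi]
    · intro i _ hi
      simp [t', hi]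
  rw [← h2, ← h1, ← lintegral_indicator_one (measurable_pi_lambda _ hmo
    (MeasurableSet.pi s.countable_toSet fun i _ => ht i))]
  refine lintegral_congr fun ω => ?_
  rw [← Finset.prod_subset hn]
  · simp only [indicator, mem_preimage, Set.mem_pi, Finset.mem_coe, Pi.one_apply]
    rw [Finset.prod_ite_zero]
    simp only [Finset.prod_const_one]
    congr 1
    refine propext (forall₂_congr fun i hi => ?_)
    simp [t', Finset.mem_coe.1 hi]
  · intro i _ hi
    simp [t', hi]

end Chain

/-! ### The survival function of a marked renewal process -/

lemma gammaMeasure_eq_withDensity (a : ℝ) :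
    gammaMeasure a 1 = (volume.restrict (Ioi 0)).withDensity fun x =>
      ENNReal.ofReal ((Real.Gamma a)⁻¹ * x ^ (a - 1) * Real.exp (-x)) := by
  rw [← withDensity_indicator measurableSet_Ioi, gammaMeasure]
  refine withDensity_congr_ae ?_
  filter_upwards [Measure.ae_ne volume (0 : ℝ)] with x hx
  rcases lt_or_gt_of_ne hx with h | h
  · rw [gammaPDF_of_neg h, indicator_of_notMem (by simpa using h.le)]
  · rw [gammaPDF_of_nonneg h.le, indicator_of_mem (by simpa using h)]
    simp

lemma lintegral_gammaMeasure (a : ℝ) {f : ℝ → ℝ≥0∞} (hf : Measurable f) :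
    ∫⁻ x, f x ∂(gammaMeasure a 1) = ∫⁻ x in Ioi 0,
      ENNReal.ofReal ((Real.Gamma a)⁻¹ * x ^ (a - 1) * Real.exp (-x)) * f x := by
  rw [gammaMeasure_eq_withDensity, lintegral_withDensity_eq_lintegral_mul _ (by fun_prop) hf]
  rfl

lemma lintegral_expMeasure {f : ℝ → ℝ≥0∞} (hf : Measurable f) :
    ∫⁻ x, f x ∂(expMeasure 1) = ∫⁻ x in Ioi 0, ENNReal.ofReal (Real.exp (-x)) * f x := by
  rw [expMeasure, lintegral_gammaMeasure 1 hf]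
  simp

section Survival

variable {h : ℝ → ℝ} {T : ℝ}

lemma abs_one_sub_le (h0 : ∀ t, 0 ≤ h t) (h1 : ∀ t, h t ≤ 1) (t : ℝ) : ‖1 - h t‖ ≤ 1 := by
  rw [Real.norm_eq_abs, abs_le]
  constructor <;> linarith [h0 t, h1 t]

lemma locallyIntegrable_one_sub (hm : Measurable h) (h0 : ∀ t, 0 ≤ h t) (h1 : ∀ t, h t ≤ 1) :
    LocallyIntegrable (fun t => 1 - h t) volume :=
  (locallyIntegrable_const (1 : ℝ)).mono (by fun_prop)
    (ae_of_all _ fun t => by simpa using abs_one_sub_le h0 h1 t)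

lemma integral_one_sub_nonpos (h1 : ∀ t, h t ≤ 1) (hT : ∀ t, T < t → h t = 1) (s : ℝ) :
    ∫ t in T..s, (1 - h t) ≤ 0 := by
  rcases le_total s T with hs | hs
  · rw [intervalIntegral.integral_symm]
    have := intervalIntegral.integral_nonneg (μ := volume) hs (f := fun t => 1 - h t)
      fun t _ => by linarith [h1 t]
    linarith
  · refine le_of_eq (intervalIntegral.integral_zero_ae (ae_of_all _ fun t ht => ?_))
    rw [uIoc_of_le hs] at ht
    rw [hT t ht.1, sub_self]

/-- The fundamental identity of the marked renewal process with standard exponential waiting times: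
if a point at time `t` is accepted with probability `h t`, the probability that all points after
time `s` are accepted is `exp (-∫_s^T (1 - h))`. The function `h` being only measurable, this is
the fundamental theorem of calculus for absolutely continuous functions. -/
lemma lintegral_expMeasure_survival (hm : Measurable h) (h0 : ∀ t, 0 ≤ h t) (h1 : ∀ t, h t ≤ 1)
    (hT : ∀ t, T < t → h t = 1) (s : ℝ) :
    ∫⁻ x, ENNReal.ofReal (h (s + x) * Real.exp (∫ t in T..(s + x), (1 - h t))) ∂(expMeasure 1) =
      ENNReal.ofReal (Real.exp (∫ t in T..s, (1 - h t))) := by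
  set A : ℝ → ℝ := fun y => ∫ t in T..y, (1 - h t) with hA
  have hli := locallyIntegrable_one_sub hm h0 h1
  have hii : ∀ a b, IntervalIntegrable (fun t => 1 - h t) volume a b := fun a b =>
    (hli.integrableOn_isCompact isCompact_uIcc).intervalIntegrable
  have hAsub : ∀ x y, A x - A y = ∫ t in y..x, (1 - h t) := fun x y =>
    intervalIntegral.integral_interval_sub_left (hii _ _) (hii _ _)
  have hAlip : LipschitzWith 1 A := LipschitzWith.of_dist_le_mul fun x y => by
    rw [Real.dist_eq, hAsub, Real.dist_eq]
    simpa using intervalIntegral.norm_integral_le_of_norm_le_const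
      (fun t _ => abs_one_sub_le h0 h1 t)
  have hAcont : Continuous A := hAlip.continuous
  set Φ : ℝ → ℝ := fun x => Real.exp (A (s + x) - x) with hΦ
  have hΦcont : Continuous Φ := by fun_prop
  have hderiv : ∀ᵐ x : ℝ, HasDerivAt Φ (-(h (s + x) * Φ x)) x := by
    have e := (measurePreserving_add_left (volume : Measure ℝ) s).quasiMeasurePreserving.ae
      (LocallyIntegrable.ae_hasDerivAt_integral hli)
    filter_upwards [e] with x hx
    have hx' : HasDerivAt (fun y => A (s + y)) (1 - h (s + x)) x := by
      simpa using (hx T).comp_const_add s x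
    convert! (hx'.sub (hasDerivAt_id x)).exp using 1
    simp only [hΦ, Pi.sub_apply, id]
    ring
  -- `Φ` is a primitive of its almost everywhere derivative, being the exponential of a Lipschitz
  -- function on a compact interval
  have hint : ∀ b, 0 ≤ b → ∫⁻ x in Ioc 0 b, ENNReal.ofReal (h (s + x) * Φ x) =
      ENNReal.ofReal (Φ 0 - Φ b) := by
    intro b hb
    have hL : LipschitzOnWith 2 (fun x => A (s + x) - x) (uIcc 0 b) := by
      have l1 : LipschitzWith 1 fun x => A (s + x) := by
        refine LipschitzWith.of_dist_le_mul fun x y => ?_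
        simpa using hAlip.dist_le_mul (s + x) (s + y)
      have := l1.sub (LipschitzWith.id (α := ℝ))
      norm_num at this
      exact this.lipschitzOnWith
    obtain ⟨c, d, hcd⟩ : ∃ c d, MapsTo (fun x => A (s + x) - x) (uIcc 0 b) (Icc c d) := by
      obtain ⟨d, hd⟩ := (isCompact_uIcc (a := (0 : ℝ)) (b := b)).bddAbove_image
        (f := fun x => A (s + x) - x) (by fun_prop)
      obtain ⟨c, hc⟩ := (isCompact_uIcc (a := (0 : ℝ)) (b := b)).bddBelow_image
        (f := fun x => A (s + x) - x) (by fun_prop)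
      exact ⟨c, d, fun x hx => ⟨hc ⟨x, hx, rfl⟩, hd ⟨x, hx, rfl⟩⟩⟩
    obtain ⟨K, hK⟩ := (Real.contDiff_exp (n := 1)).contDiffOn.exists_lipschitzOnWith (by decide)
      (convex_Icc c d) isCompact_Icc
    have hac : AbsolutelyContinuousOnInterval Φ 0 b :=
      (hK.comp hL hcd).absolutelyContinuousOnInterval
    have h2 := hac.integral_deriv_eq_sub
    have h3 : ∫ x in (0 : ℝ)..b, deriv Φ x = -∫ x in (0 : ℝ)..b, h (s + x) * Φ x := by
      rw [← intervalIntegral.integral_neg]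
      refine intervalIntegral.integral_congr_ae ?_
      filter_upwards [hderiv] with x hx _ using hx.deriv
    have hii : IntegrableOn (fun x => h (s + x) * Φ x) (Ioc 0 b) := by
      have : IntegrableOn Φ (Ioc 0 b) := hΦcont.integrableOn_Ioc
      have hmeas : Measurable fun x => h (s + x) * Φ x := by fun_prop
      refine Integrable.mono this hmeas.aestronglyMeasurable (ae_of_all _ fun x => ?_)
      rw [norm_mul, Real.norm_of_nonneg (h0 _)]
      exact mul_le_of_le_one_left (norm_nonneg _) (h1 _)
    rw [← ofReal_integral_eq_lintegral_ofReal hii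
      (ae_of_all _ fun x => mul_nonneg (h0 _) (Real.exp_pos _).le),
      ← intervalIntegral.integral_of_le hb]
    congr 1
    linarith
  have hstart : ∫⁻ x, ENNReal.ofReal (h (s + x) * Real.exp (A (s + x))) ∂(expMeasure 1) =
      ∫⁻ x in Ioi 0, ENNReal.ofReal (h (s + x) * Φ x) := by
    rw [lintegral_expMeasure (by fun_prop)]
    refine lintegral_congr fun x => ?_
    rw [← ENNReal.ofReal_mul (Real.exp_pos _).le, hΦ]
    congr 1
    simp only [sub_eq_add_neg, Real.exp_add]
    ring
  rw [hstart]
  have hU : ⋃ n : ℕ, Ioc (0 : ℝ) n = Ioi 0 := by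
    ext x
    simp only [mem_iUnion, mem_Ioc, mem_Ioi]
    exact ⟨fun ⟨_, h, _⟩ => h, fun hx => (exists_nat_ge x).imp fun n hn => ⟨hx, hn⟩⟩
  have t1 : Tendsto (fun n : ℕ => ∫⁻ x in Ioc 0 (n : ℝ), ENNReal.ofReal (h (s + x) * Φ x)) atTop
      (𝓝 (∫⁻ x in Ioi 0, ENNReal.ofReal (h (s + x) * Φ x))) := by
    have := tendsto_measure_iUnion_atTop
      (μ := volume.withDensity fun x => ENNReal.ofReal (h (s + x) * Φ x))
      (s := fun n : ℕ => Ioc (0 : ℝ) n)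
      fun m n hmn => Ioc_subset_Ioc_right (by exact_mod_cast hmn)
    simpa only [Function.comp_def, hU, withDensity_apply _ measurableSet_Ioc, withDensity_apply _ measurableSet_Ioi]
      using this
  have t2 : Tendsto (fun n : ℕ => ENNReal.ofReal (Φ 0 - Φ n)) atTop (𝓝 (ENNReal.ofReal (Φ 0))) := by
    have h0 : Tendsto (fun n : ℕ => Φ n) atTop (𝓝 0) := by
      refine squeeze_zero (fun n => (Real.exp_pos _).le) (fun n => ?_)
        (Real.tendsto_exp_neg_atTop_nhds_zero.comp tendsto_natCast_atTop_atTop)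
      simp only [hΦ, Function.comp]
      exact Real.exp_le_exp.2 (by linarith [integral_one_sub_nonpos h1 hT (s + n)])
    simpa using ENNReal.tendsto_ofReal (h0.const_sub (Φ 0))
  have t3 := t2.congr fun n : ℕ => (hint n n.cast_nonneg).symm
  rw [tendsto_nhds_unique t1 t3]
  simp [hΦ, hA]

end Survival

/-! ### Marked Poisson processes on the half-line -/

/-- A random counting measure with the Laplace functional of a Poisson process is a Poisson
process. -/
theorem isPoissonProcess_of_laplace_functional {Ω X : Type} [MeasurableSpace Ω] [MeasurableSpace X]
    {N : Ω → Measure X} {μ : Measure X} {P : Measure Ω} [IsProbabilityMeasure P]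
    (hN : Measurable N)
    (hc : ∀ᵐ ω ∂P, ∃ (ι : Type) (_ : Countable ι) (x : ι → X),
      N ω = Measure.sum fun i => Measure.dirac (x i))
    (h : ∀ f : X → ℝ≥0∞, Measurable f →
      ∫⁻ ω, expNeg (∫⁻ x, f x ∂(N ω)) ∂P = expNeg (∫⁻ x, (1 - expNeg (f x)) ∂μ)) :
    IsPoissonProcess N μ P := by
  refine isPoissonProcess_of_laplace hN hc fun n B hB hd m => ?_
  have hf : Measurable fun x => ∑ i, (B i).indicator (fun _ => (m i : ℝ≥0∞)) x :=
    Finset.measurable_sum _ fun i _ => measurable_const.indicator (hB i)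
  have h1 := h _ hf
  have hint : ∀ ρ : Measure X, ∫⁻ x, ∑ i, (B i).indicator (fun _ => (m i : ℝ≥0∞)) x ∂ρ =
      ∑ i, m i * ρ (B i) := fun ρ => by
    rw [lintegral_finsetSum _ fun i _ => measurable_const.indicator (hB i)]
    simp [hB]
  have hexp : ∀ x, 1 - expNeg (∑ i, (B i).indicator (fun _ => (m i : ℝ≥0∞)) x) =
      ∑ i, (B i).indicator (fun _ => ENNReal.ofReal (1 - Real.exp (-m i))) x := by
    intro x
    by_cases hx : ∃ i, x ∈ B i
    · obtain ⟨i, hi⟩ := hx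
      have hne : ∀ j, j ≠ i → x ∉ B j := fun j hj hxj => Set.disjoint_left.1 (hd hj) hxj hi
      rw [Finset.sum_eq_single i (fun j _ hj => indicator_of_notMem (hne j hj) _) (by simp),
        Finset.sum_eq_single i (fun j _ hj => indicator_of_notMem (hne j hj) _) (by simp),
        indicator_of_mem hi, indicator_of_mem hi, ← ENNReal.ofReal_natCast,
        expNeg_ofReal (by positivity), ENNReal.ofReal_sub _ (Real.exp_pos _).le,
        ENNReal.ofReal_one]
    · push Not at hx
      simp [hx]
  simp only [hint, hexp] at h1
  simp only [expNeg_sum, expNeg_nsmul] at h1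
  rw [h1, lintegral_finsetSum _ fun i _ => measurable_const.indicator (hB i), expNeg_sum]
  simp [hB]

/-- An almost surely nonincreasing sequence whose integrals tend to zero tends to zero almost
surely. -/
lemma ae_tendsto_zero_of_antitone {Ω : Type*} [MeasurableSpace Ω] {P : Measure Ω}
    {f : ℕ → Ω → ℝ≥0∞} (hf : ∀ n, Measurable (f n)) (ha : ∀ᵐ ω ∂P, Antitone fun n => f n ω)
    (h : Tendsto (fun n => ∫⁻ ω, f n ω ∂P) atTop (𝓝 0)) :
    ∀ᵐ ω ∂P, Tendsto (fun n => f n ω) atTop (𝓝 0) := by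
  have h0 : ∫⁻ ω, ⨅ n, f n ω ∂P = 0 := by
    refine le_antisymm (ge_of_tendsto' h fun n => lintegral_mono fun ω => iInf_le _ n) bot_le
  rw [lintegral_eq_zero_iff (.iInf hf)] at h0
  filter_upwards [h0, ha] with ω h1 h2
  have := tendsto_atTop_iInf h2
  rwa [h1] at this

instance : IsProbabilityMeasure (expMeasure 1) := isProbabilityMeasure_expMeasure one_pos

lemma ae_pos_gammaMeasure (a : ℝ) : ∀ᵐ x ∂(gammaMeasure a 1), 0 < x := by
  rw [gammaMeasure_eq_withDensity]
  exact (withDensity_absolutelyContinuous _ _).ae_le (ae_restrict_mem measurableSet_Ioi)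

section MarkedPoisson

variable {X : Type} [MeasurableSpace X]

/-- The partial sums `Γₙ = Γ₀ + X₀ + ⋯ + Xₙ₋₁` as a function of `(Γ₀, (Xₙ, Gₙ)ₙ)`, where the `Gₙ`
are further marks. -/
def arrival {X : Type} : ℕ → ℝ × (ℕ → ℝ × X) → ℝ := chain fun _ s x => s + x.1

/-- The `n`-th point `(Γₙ, Gₙ)` of the marked point process. -/
def markedPoint {X : Type} (n : ℕ) (ω : ℝ × (ℕ → ℝ × X)) : ℝ × X := (arrival n ω, (ω.2 n).2)

lemma arrival_succ {X : Type} (n : ℕ) (ω : ℝ × (ℕ → ℝ × X)) :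
    arrival (n + 1) ω = arrival n ω + (ω.2 n).1 := rfl

lemma measurable_arrival_pastAlgebra (n : ℕ) :
    Measurable[pastAlgebra ℝ (ℝ × X) n] (arrival (X := X) n) :=
  measurable_chain_pastAlgebra (φ := fun _ s (x : ℝ × X) => s + x.1)
    (fun _ => measurable_fst.add measurable_snd.fst) n

@[fun_prop]
lemma measurable_arrival (n : ℕ) : Measurable (arrival (X := X) n) :=
  (measurable_arrival_pastAlgebra n).mono (pastAlgebra_le n) le_rfl

@[fun_prop]
lemma measurable_markedPoint (n : ℕ) : Measurable (markedPoint (X := X) n) := by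
  unfold markedPoint
  fun_prop

lemma measurable_markedPoint_pastAlgebra {k n : ℕ} (h : k < n) :
    Measurable[pastAlgebra ℝ (ℝ × X) n] (markedPoint (X := X) k) :=
  ((measurable_arrival_pastAlgebra k).mono (pastAlgebra_mono h.le) le_rfl).prodMk
    (measurable_eval_pastAlgebra h).snd

/-- The law of the sequence of innovations `(Xₙ, Gₙ)`: independent, `Xₙ` standard exponential and
`Gₙ` of law `ν`. -/
def innovationLaw (ν : Measure X) : Measure (ℕ → ℝ × X) :=
  Measure.infinitePi fun _ => (expMeasure 1).prod ν

variable (ν : Measure X) [IsProbabilityMeasure ν]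

instance : IsProbabilityMeasure (innovationLaw ν) := by
  unfold innovationLaw
  infer_instance

lemma ae_innovation_pos : ∀ᵐ x ∂(innovationLaw ν), ∀ n, 0 < (x n).1 := by
  refine ae_all_iff.2 fun n => ?_
  have h1 : (innovationLaw ν).map (fun x => (x n).1) = expMeasure 1 := by
    rw [← Function.comp_def Prod.fst (fun x : ℕ → ℝ × X => x n),
      ← Measure.map_map measurable_fst (measurable_pi_apply n), innovationLaw,
      Measure.infinitePi_map_eval, Measure.map_fst_prod]
    simp
  refine ae_of_ae_map (f := fun x : ℕ → ℝ × X => (x n).1) (p := fun x => 0 < x)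
    (Measurable.aemeasurable (by fun_prop)) ?_
  rw [h1]
  exact ae_pos_gammaMeasure 1

lemma ae_strictMono_arrival (σ : Measure ℝ) [SFinite σ] :
    ∀ᵐ ω ∂(σ.prod (innovationLaw ν)), StrictMono fun n => arrival n ω := by
  have h := (Measure.quasiMeasurePreserving_snd (μ := σ) (ν := innovationLaw ν)).ae
    (ae_innovation_pos ν)
  filter_upwards [h] with ω h1
  refine strictMono_nat_of_lt_succ fun n => ?_
  rw [arrival_succ]
  linarith [h1 n]

lemma lintegral_exp_neg_expMeasure :
    ∫⁻ x, ENNReal.ofReal (Real.exp (-x)) ∂(expMeasure 1) = ENNReal.ofReal (1 / 2) := by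
  rw [lintegral_expMeasure (by fun_prop)]
  have h1 : ∀ x : ℝ, ENNReal.ofReal (Real.exp (-x)) * ENNReal.ofReal (Real.exp (-x)) =
      ENNReal.ofReal (Real.exp (-2 * x)) := fun x => by
    rw [← ENNReal.ofReal_mul (Real.exp_pos _).le, ← Real.exp_add]
    ring_nf
  simp_rw [h1]
  rw [← ofReal_integral_eq_lintegral_ofReal (integrableOn_exp_mul_Ioi (by norm_num) 0)
    (ae_of_all _ fun x => (Real.exp_pos _).le), integral_exp_mul_Ioi (by norm_num)]
  norm_num

lemma ae_tendsto_arrival :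
    ∀ᵐ ω ∂((expMeasure 1).prod (innovationLaw ν)), Tendsto (fun n => arrival n ω) atTop atTop := by
  have hE : ∀ n, ∫⁻ ω, ENNReal.ofReal (Real.exp (-arrival n ω))
      ∂((expMeasure 1).prod (innovationLaw ν)) = ENNReal.ofReal (1 / 2) ^ (n + 1) := by
    intro n
    induction n with
    | zero =>
      simp only [arrival, chain]
      rw [← lintegral_map (f := fun x => ENNReal.ofReal (Real.exp (-x))) (g := Prod.fst)
        (by fun_prop) measurable_fst, Measure.map_fst_prod, measure_univ, one_smul,
        lintegral_exp_neg_expMeasure, zero_add, pow_one]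
    | succ n ih =>
      have h1 := lintegral_step (σ := expMeasure 1) (lam := fun _ => (expMeasure 1).prod ν)
        (measurable_arrival_pastAlgebra (X := X) n)
        (F := fun t x => ENNReal.ofReal (Real.exp (-t)) * ENNReal.ofReal (Real.exp (-x.1)))
        (by fun_prop)
      have h2 : ∀ t : ℝ, ∫⁻ x, ENNReal.ofReal (Real.exp (-t)) * ENNReal.ofReal (Real.exp (-x.1))
          ∂((expMeasure 1).prod ν) = ENNReal.ofReal (Real.exp (-t)) * ENNReal.ofReal (1 / 2) := by
        intro t
        rw [lintegral_const_mul _ (by fun_prop), ← lintegral_exp_neg_expMeasure,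
          lintegral_prod _ (by fun_prop)]
        simp
      simp only [h2] at h1
      rw [lintegral_mul_const _ (by fun_prop)] at h1
      simp only [arrival_succ, neg_add, Real.exp_add]
      rw [pow_succ, ← ih]
      exact (lintegral_congr fun ω => ENNReal.ofReal_mul (Real.exp_pos _).le).trans h1
  have ht := ae_tendsto_zero_of_antitone (P := (expMeasure 1).prod (innovationLaw ν))
    (f := fun n ω => ENNReal.ofReal (Real.exp (-arrival n ω))) (fun n => by fun_prop) (by
      filter_upwards [ae_strictMono_arrival ν (expMeasure 1)] with ω h1 m n hmn
      exact ENNReal.ofReal_le_ofReal (Real.exp_le_exp.2 (neg_le_neg (h1.monotone hmn)))) (by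
      simp_rw [hE]
      refine (tendsto_add_atTop_iff_nat 1).2 (ENNReal.tendsto_pow_atTop_nhds_zero_of_lt_one ?_)
      rw [ENNReal.ofReal_lt_one]
      norm_num)
  filter_upwards [ht] with ω h1
  have h2 : Tendsto (fun n => Real.exp (-arrival n ω)) atTop (𝓝 0) := by
    have := (ENNReal.tendsto_toReal ENNReal.zero_ne_top).comp h1
    simpa [Function.comp_def, (Real.exp_pos _).le] using this
  exact tendsto_neg_atBot_iff.1 (Real.tendsto_exp_comp_nhds_zero.1 h2)

/-- The multiplicative functional of the marked process, for functions equal to one after a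
time `T`. With `h t = ∫ u (t, x) ν(dx)`, `ψ s = exp (-∫_s^T (1 - h))` is the expected product over the
points after a time `s` and `χ = h ψ` the one over the points from a point at time `t` on, so that
`u(p₀) ⋯ u(pₙ₋₁) χ(Γₙ)` is a martingale; it converges to the infinite product. -/
lemma lintegral_iInf_prod_of_eq_one {u : ℝ × X → ℝ≥0∞} (hu : Measurable u) (hu1 : ∀ p, u p ≤ 1)
    {T : ℝ} (hT0 : 0 ≤ T) (hT : ∀ t x, T < t → u (t, x) = 1) :
    ∫⁻ ω, ⨅ n, ∏ k ∈ Finset.range n, u (markedPoint k ω) ∂((expMeasure 1).prod (innovationLaw ν)) =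
      expNeg (∫⁻ p, (1 - u p) ∂(timeMeasure.prod ν)) := by
  let hE : ℝ → ℝ≥0∞ := fun t => ∫⁻ x, u (t, x) ∂ν
  have hEm : Measurable hE := hu.lintegral_prod_right'
  have hE1 : ∀ t, hE t ≤ 1 := fun t => by
    simpa using lintegral_mono (μ := ν) (fun x => hu1 (t, x))
  have hEt : ∀ t, hE t ≠ ∞ := fun t => ((hE1 t).trans_lt ENNReal.one_lt_top).ne
  let h : ℝ → ℝ := fun t => (hE t).toReal
  have hm : Measurable h := hEm.ennreal_toReal
  have h0 : ∀ t, 0 ≤ h t := fun t => ENNReal.toReal_nonneg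
  have h1 : ∀ t, h t ≤ 1 := fun t =>
    ENNReal.toReal_le_of_le_ofReal zero_le_one (by simpa using hE1 t)
  have hhT : ∀ t, T < t → h t = 1 := fun t ht => by
    simp [h, hE, hT t _ ht]
  have hsurv := lintegral_expMeasure_survival hm h0 h1 hhT
  have hAcont : Continuous fun s => ∫ t in T..s, (1 - h t) :=
    intervalIntegral.continuous_primitive (fun a b =>
      ((locallyIntegrable_one_sub hm h0 h1).integrableOn_isCompact
        isCompact_uIcc).intervalIntegrable) T
  set ψ : ℝ → ℝ := fun s => Real.exp (∫ t in T..s, (1 - h t)) with hψ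
  have hψm : Measurable ψ := (Real.continuous_exp.comp hAcont).measurable
  have hψ1 : ∀ s, ψ s ≤ 1 := fun s => Real.exp_le_one_iff.2 (integral_one_sub_nonpos h1 hhT s)
  set χ : ℝ → ℝ≥0∞ := fun t => ENNReal.ofReal (h t * ψ t) with hχ
  have hχm : Measurable χ := by fun_prop
  have hχ1 : ∀ t, χ t ≤ 1 := fun t => by
    rw [hχ, ENNReal.ofReal_le_one]
    exact mul_le_one₀ (h1 t) (Real.exp_pos _).le (hψ1 t)
  have hstep : ∀ n, ∫⁻ ω, (∏ k ∈ Finset.range n, u (markedPoint k ω)) * χ (arrival n ω)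
      ∂((expMeasure 1).prod (innovationLaw ν)) = ENNReal.ofReal (ψ 0) := by
    intro n
    induction n with
    | zero =>
      simp only [arrival, chain, Finset.range_zero, Finset.prod_empty, one_mul]
      rw [← lintegral_map (g := Prod.fst) hχm measurable_fst, Measure.map_fst_prod, measure_univ,
        one_smul, hψ, ← hsurv 0]
      simp [hχ, hψ]
    | succ n ih =>
      have hp : Measurable[pastAlgebra ℝ (ℝ × X) n] fun ω =>
          (∏ k ∈ Finset.range n, u (markedPoint k ω), arrival n ω) :=
        (Finset.measurable_prod _ fun i hi => hu.comp
          (measurable_markedPoint_pastAlgebra (Finset.mem_range.1 hi))).prodMk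
          (measurable_arrival_pastAlgebra n)
      have hF : Measurable (Function.uncurry fun (w : ℝ≥0∞ × ℝ) (x : ℝ × X) =>
          w.1 * (u (w.2, x.2) * χ (w.2 + x.1))) := by
        unfold Function.uncurry
        fun_prop
      have h2 : ∀ (w : ℝ≥0∞) (t : ℝ), ∫⁻ x, w * (u (t, x.2) * χ (t + x.1))
          ∂((expMeasure 1).prod ν) = w * χ t := by
        intro w t
        rw [lintegral_const_mul _ (by fun_prop)]
        congr 1
        have e : ∀ x : ℝ × X, u (t, x.2) * χ (t + x.1) = χ (t + x.1) * u (t, x.2) :=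
          fun x => mul_comm _ _
        simp_rw [e]
        rw [lintegral_prod_mul (f := fun x => χ (t + x)) (g := fun x => u (t, x))
          (by fun_prop) (by fun_prop), hχ]
        simp only
        rw [hsurv t, mul_comm, ENNReal.ofReal_mul (h0 t)]
        congr 1
        exact (ENNReal.ofReal_toReal (hEt t)).symm
      have h3 := (lintegral_step (σ := expMeasure 1) (lam := fun _ => (expMeasure 1).prod ν)
        hp hF).trans (lintegral_congr fun ω => h2 _ (arrival n ω))
      rw [← ih, innovationLaw, ← h3]
      refine lintegral_congr fun ω => ?_
      rw [Finset.prod_range_succ, mul_assoc]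
      rfl
  have hanti : ∀ ω : ℝ × (ℕ → ℝ × X),
      Antitone fun n => ∏ k ∈ Finset.range n, u (markedPoint k ω) := fun ω =>
    antitone_nat_of_succ_le fun n => by
      rw [Finset.prod_range_succ]
      exact mul_le_of_le_one_right' (hu1 _)
  have hlim : Tendsto (fun n => ∫⁻ ω, (∏ k ∈ Finset.range n, u (markedPoint k ω)) *
      χ (arrival n ω) ∂((expMeasure 1).prod (innovationLaw ν))) atTop
      (𝓝 (∫⁻ ω, ⨅ n, ∏ k ∈ Finset.range n, u (markedPoint k ω)
        ∂((expMeasure 1).prod (innovationLaw ν)))) := by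
    refine tendsto_lintegral_of_dominated_convergence (fun _ => 1) (fun n => ?_) (fun n => ?_)
      (by simp) ?_
    · fun_prop
    · refine ae_of_all _ fun ω => ?_
      exact mul_le_one' (Finset.prod_le_one' fun k _ => hu1 _) (hχ1 _)
    · filter_upwards [ae_tendsto_arrival ν] with ω hω
      refine (tendsto_atTop_iInf (hanti ω)).congr' ?_
      filter_upwards [hω.eventually_gt_atTop T] with n hn
      have : ∫ t in T..arrival n ω, (1 - h t) = 0 := by
        refine intervalIntegral.integral_zero_ae (ae_of_all _ fun t ht => ?_)
        rw [uIoc_of_le hn.le] at ht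
        rw [hhT t ht.1, sub_self]
      simp [hχ, hψ, hhT _ hn, this]
  simp_rw [hstep] at hlim
  rw [tendsto_nhds_unique hlim tendsto_const_nhds, hψ]
  simp only
  rw [intervalIntegral.integral_symm, ← expNeg_ofReal
    (intervalIntegral.integral_nonneg hT0 fun t _ => by linarith [h1 t])]
  congr 1
  rw [lintegral_prod _ (by fun_prop), timeMeasure]
  have e1 : ∀ t, ∫⁻ x, (1 - u (t, x)) ∂ν = ENNReal.ofReal (1 - h t) := fun t => by
    rw [lintegral_sub (by fun_prop) (hEt t) (ae_of_all _ fun x => hu1 _),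
      ENNReal.ofReal_sub _ (h0 t)]
    simp only [lintegral_const, measure_univ, mul_one, ENNReal.ofReal_one]
    congr 1
    exact (ENNReal.ofReal_toReal (hEt t)).symm
  simp_rw [e1]
  rw [intervalIntegral.integral_of_le hT0, ofReal_integral_eq_lintegral_ofReal
    ((locallyIntegrable_one_sub hm h0 h1).integrableOn_isCompact isCompact_Icc |>.mono_set
      Ioc_subset_Icc_self) (ae_of_all _ fun t => by simpa using h1 t),
    ← Ioc_union_Ioi_eq_Ioi hT0, lintegral_union measurableSet_Ioi
      (Ioc_disjoint_Ioi_same)]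
  rw [setLIntegral_congr_fun (g := fun _ => 0) measurableSet_Ioi (fun t ht => by
    simp [hhT t ht])]
  simp

/-- The multiplicative functional of the marked process: the general case follows by replacing `u`
with `1` after time `m` and letting `m → ∞`. -/
lemma lintegral_iInf_prod {u : ℝ × X → ℝ≥0∞} (hu : Measurable u) (hu1 : ∀ p, u p ≤ 1) :
    ∫⁻ ω, ⨅ n, ∏ k ∈ Finset.range n, u (markedPoint k ω) ∂((expMeasure 1).prod (innovationLaw ν)) =
      expNeg (∫⁻ p, (1 - u p) ∂(timeMeasure.prod ν)) := by
  classical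
  let uT : ℕ → ℝ × X → ℝ≥0∞ := fun m p => if p.1 ≤ m then u p else 1
  have huT : ∀ m, Measurable (uT m) := fun m =>
    Measurable.ite (measurableSet_le measurable_fst measurable_const) hu measurable_const
  have huT1 : ∀ m p, uT m p ≤ 1 := fun m p => by
    simp only [uT]
    split_ifs
    exacts [hu1 p, le_rfl]
  have huanti : ∀ p, Antitone fun m => uT m p := fun p m n hmn => by
    simp only [uT]
    split_ifs with h1 h2 h2
    · exact le_rfl
    · exact hu1 p
    · exact absurd (h2.trans (by exact_mod_cast hmn)) h1
    · exact le_rfl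
  have hle : ∀ m p, u p ≤ uT m p := fun m p => by
    simp only [uT]
    split_ifs
    exacts [le_rfl, hu1 p]
  have hV : ∀ ω : ℝ × (ℕ → ℝ × X), ⨅ n, ∏ k ∈ Finset.range n, u (markedPoint k ω) =
      ⨅ m, ⨅ n, ∏ k ∈ Finset.range n, uT m (markedPoint k ω) := by
    intro ω
    refine le_antisymm (le_iInf fun m => iInf_mono fun n =>
      Finset.prod_le_prod' fun k _ => hle m _) (le_iInf fun n => ?_)
    obtain ⟨m, hm⟩ : ∃ m : ℕ, ∀ k ∈ Finset.range n, arrival k ω ≤ m := by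
      obtain ⟨C, hC⟩ := ((Finset.range n).image fun k => arrival k ω).bddAbove
      obtain ⟨m, hm⟩ := exists_nat_ge C
      exact ⟨m, fun k hk => (hC (Finset.mem_image_of_mem _ hk)).trans hm⟩
    refine (iInf_le _ m).trans ((iInf_le _ n).trans (Finset.prod_le_prod' fun k hk => ?_))
    simp [uT, markedPoint, hm k hk]
  simp_rw [hV]
  rw [lintegral_iInf (f := fun m ω => ⨅ n, ∏ k ∈ Finset.range n, uT m (markedPoint k ω))
    (fun m => .iInf fun n => by fun_prop) (fun m n hmn ω => iInf_mono fun l =>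
    Finset.prod_le_prod' fun k _ => huanti _ hmn)]
  · have h1 := fun m => lintegral_iInf_prod_of_eq_one ν (huT m) (huT1 m) (T := m) m.cast_nonneg
      fun t x ht => by simp [uT, not_le.2 ht]
    simp_rw [h1]
    have hmono : ∀ p, Monotone fun m => 1 - uT m p := fun p m n hmn =>
      tsub_le_tsub_left (huanti p hmn) 1
    have hmono' : Monotone fun m => ∫⁻ p, (1 - uT m p) ∂(timeMeasure.prod ν) := fun m n hmn =>
      lintegral_mono fun p => hmono p hmn
    refine tendsto_nhds_unique (tendsto_atTop_iInf (expNeg_antitone.comp_monotone hmono')) ?_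
    refine (continuous_expNeg.tendsto _).comp ?_
    refine lintegral_tendsto_of_tendsto_of_monotone (fun m => by fun_prop)
      (ae_of_all _ hmono) (ae_of_all _ fun p => ?_)
    refine tendsto_const_nhds.congr' ?_
    obtain ⟨m, hm⟩ := exists_nat_ge p.1
    filter_upwards [eventually_ge_atTop m] with n hn
    simp [uT, hm.trans (by exact_mod_cast hn : (m : ℝ) ≤ n)]
  · refine ne_top_of_le_ne_top ENNReal.one_ne_top ?_
    calc _ ≤ ∫⁻ _, 1 ∂((expMeasure 1).prod (innovationLaw ν)) :=
          lintegral_mono fun ω => (iInf_le _ 0).trans (by simp)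
      _ = 1 := by simp

/-- The marked renewal process with standard exponential waiting times and independent marks of
law `ν` is a Poisson process with intensity `dt ⊗ ν`. -/
theorem isPoissonProcess_markedPoint :
    IsPoissonProcess (fun ω => Measure.sum fun n => Measure.dirac (markedPoint n ω))
      (timeMeasure.prod ν) ((expMeasure 1).prod (innovationLaw ν)) := by
  refine isPoissonProcess_of_laplace_functional ?_
    (ae_of_all _ fun ω => ⟨ℕ, inferInstance, _, rfl⟩) fun f hf => ?_
  · refine Measure.measurable_of_measurable_coe _ fun s hs => ?_
    simp only [Measure.sum_apply _ hs]
    exact Measurable.tsum fun n => (Measure.measurable_coe hs).comp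
      (Measure.measurable_dirac.comp (measurable_markedPoint n))
  · rw [← lintegral_iInf_prod ν (u := fun p => expNeg (f p)) (by fun_prop)
      fun p => expNeg_le_one _]
    refine lintegral_congr fun ω => ?_
    rw [lintegral_sum_measure]
    simp_rw [lintegral_dirac' _ hf, ← expNeg_sum]
    refine tendsto_nhds_unique
      ((continuous_expNeg.tendsto _).comp ENNReal.summable.hasSum.tendsto_sum_nat) ?_
    exact tendsto_atTop_iInf (expNeg_antitone.comp_monotone fun m n hmn =>
      Finset.sum_le_sum_of_subset (Finset.range_mono hmn))

end MarkedPoisson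

/-! ### Changes of variables on the half-line -/

lemma lintegral_Ioi_comp_mul {c : ℝ} (hc : 0 < c) (f : ℝ → ℝ≥0∞) :
    ∫⁻ x in Ioi 0, f x = ∫⁻ z in Ioi 0, ENNReal.ofReal c * f (c * z) := by
  have h := lintegral_image_eq_lintegral_abs_deriv_mul (f := fun z => c * z) (f' := fun _ => c)
    (measurableSet_Ioi (a := (0 : ℝ)))
    (fun z _ => by simpa using ((hasDerivAt_id z).const_mul c).hasDerivWithinAt)
    (mul_right_injective₀ hc.ne').injOn f
  rw [image_mul_left_Ioi hc, mul_zero, abs_of_pos hc] at h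
  exact h

lemma lintegral_Ioo_comp_mul {c : ℝ} (hc : 0 < c) (f : ℝ → ℝ≥0∞) :
    ∫⁻ x in Ioo 0 c, f x = ∫⁻ z in Ioo 0 1, ENNReal.ofReal c * f (c * z) := by
  have h := lintegral_image_eq_lintegral_abs_deriv_mul (f := fun z => c * z) (f' := fun _ => c)
    (measurableSet_Ioo (a := (0 : ℝ)) (b := 1))
    (fun z _ => by simpa using ((hasDerivAt_id z).const_mul c).hasDerivWithinAt)
    (mul_right_injective₀ hc.ne').injOn f
  rw [image_mul_left_Ioo hc, mul_zero, mul_one, abs_of_pos hc] at h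
  exact h

lemma lintegral_Ioi_comp_rpow {a : ℝ} (ha : 0 < a) (f : ℝ → ℝ≥0∞) :
    ∫⁻ x in Ioi 0, f x = ∫⁻ z in Ioi 0, ENNReal.ofReal (a * z ^ (a - 1)) * f (z ^ a) := by
  have h := lintegral_image_eq_lintegral_abs_deriv_mul (f := fun z => z ^ a)
    (f' := fun z => a * z ^ (a - 1)) (measurableSet_Ioi (a := (0 : ℝ)))
    (fun z hz => (Real.hasDerivAt_rpow_const (Or.inl (ne_of_gt hz))).hasDerivWithinAt)
    (fun z (hz : 0 < z) y (hy : 0 < y) hzy => Real.rpow_left_injOn ha.ne' hz.le hy.le hzy) f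
  have himg : (fun z : ℝ => z ^ a) '' Ioi 0 = Ioi 0 := by
    ext x
    refine ⟨fun ⟨z, hz, hx⟩ => hx ▸ Real.rpow_pos_of_pos hz a, fun hx => ?_⟩
    exact ⟨x ^ a⁻¹, Real.rpow_pos_of_pos hx _, Real.rpow_inv_rpow (le_of_lt hx) ha.ne'⟩
  rw [himg] at h
  rw [h]
  refine setLIntegral_congr_fun measurableSet_Ioi fun z hz => ?_
  rw [abs_of_nonneg (mul_nonneg ha.le (Real.rpow_nonneg (le_of_lt hz) _))]

lemma lintegral_Ioi_comp_exp_neg {r g : ℝ} (hr : 0 < r) (hg : 0 < g) (f : ℝ → ℝ≥0∞) :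
    ∫⁻ t in Ioi 0, f (g * Real.exp (-t / r)) = ∫⁻ x in Ioo 0 g, ENNReal.ofReal (r / x) * f x := by
  have h := lintegral_image_eq_lintegral_abs_deriv_mul (f := fun x => r * (Real.log g - Real.log x))
    (f' := fun x => r * -x⁻¹) (measurableSet_Ioo (a := (0 : ℝ)) (b := g))
    (fun x hx => (((Real.hasDerivAt_log hx.1.ne').const_sub _).const_mul r).hasDerivWithinAt)
    (fun x hx y hy hxy => Real.log_injOn_pos hx.1 hy.1 (by
      have := mul_left_cancel₀ hr.ne' hxy
      linarith)) (fun t => f (g * Real.exp (-t / r)))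
  have himg : (fun x => r * (Real.log g - Real.log x)) '' Ioo 0 g = Ioi 0 := by
    ext t
    constructor
    · rintro ⟨x, hx, rfl⟩
      exact mul_pos hr (sub_pos.2 (Real.log_lt_log hx.1 hx.2))
    · intro ht
      refine ⟨g * Real.exp (-t / r), ⟨by positivity, ?_⟩, ?_⟩
      · refine mul_lt_of_lt_one_right hg (Real.exp_lt_one_iff.2 ?_)
        rw [neg_div, neg_lt_zero]
        exact div_pos ht hr
      · simp only
        rw [Real.log_mul hg.ne' (Real.exp_pos _).ne', Real.log_exp]
        field_simp
        ring
  rw [himg] at h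
  rw [h]
  refine setLIntegral_congr_fun measurableSet_Ioo fun x hx => ?_
  have h1 : r / x = |r * -x⁻¹| := by
    rw [mul_neg, abs_neg, ← div_eq_mul_inv, abs_of_pos (div_pos hr hx.1)]
  have h2 : g * Real.exp (-(r * (Real.log g - Real.log x)) / r) = x := by
    rw [show -(r * (Real.log g - Real.log x)) / r = Real.log x - Real.log g by field_simp; ring,
      Real.exp_sub, Real.exp_log hx.1, Real.exp_log hg]
    field_simp
  simp only [h1, h2]

lemma lintegral_triangle_swap {F : ℝ → ℝ → ℝ≥0∞} (hF : Measurable (Function.uncurry F)) :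
    ∫⁻ x in Ioi 0, ∫⁻ s in Ioi x, F x s = ∫⁻ s in Ioi 0, ∫⁻ x in Ioo 0 s, F x s := by
  let G : ℝ → ℝ → ℝ≥0∞ := fun x s => {p : ℝ × ℝ | p.1 < p.2}.indicator (Function.uncurry F) (x, s)
  have hG : Measurable (Function.uncurry G) :=
    hF.indicator (measurableSet_lt measurable_fst measurable_snd)
  have h1 : ∀ x ∈ Ioi (0 : ℝ), ∫⁻ s in Ioi x, F x s = ∫⁻ s in Ioi 0, G x s := by
    intro x hx
    have : ∀ s, G x s = (Ioi x).indicator (F x) s := fun s => by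
      simp [G, indicator, Function.uncurry]
    simp_rw [this]
    rw [lintegral_indicator measurableSet_Ioi, Measure.restrict_restrict measurableSet_Ioi,
      Ioi_inter_Ioi, max_eq_left (le_of_lt hx)]
  have h2 : ∀ s ∈ Ioi (0 : ℝ), ∫⁻ x in Ioo 0 s, F x s = ∫⁻ x in Ioi 0, G x s := by
    intro s hs
    have : ∀ x, G x s = (Iio s).indicator (fun x => F x s) x := fun x => by
      simp [G, indicator, Function.uncurry]
    simp_rw [this]
    rw [lintegral_indicator measurableSet_Iio, Measure.restrict_restrict measurableSet_Iio,
      Iio_inter_Ioi]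
  rw [setLIntegral_congr_fun measurableSet_Ioi h1, setLIntegral_congr_fun measurableSet_Ioi h2,
    lintegral_lintegral_swap hG.aemeasurable]

/-! ### Existence of Poisson processes and the intensities of the processes of jumps -/

instance : SigmaFinite timeMeasure := by unfold timeMeasure; infer_instance

instance : SigmaFinite gammaLevy := by
  unfold gammaLevy
  exact SigmaFinite.withDensity_ofReal _

instance (α : ℝ) : SigmaFinite (stableLevy α) := by
  unfold stableLevy
  exact SigmaFinite.withDensity_ofReal _

lemma timeMeasure_setOf_le (c : ℝ≥0∞) : timeMeasure {t | ENNReal.ofReal t ≤ c} = c := by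
  rw [timeMeasure, Measure.restrict_apply (measurableSet_le (by fun_prop) measurable_const)]
  by_cases hc : c = ∞
  · simp [hc]
  · have : {t | ENNReal.ofReal t ≤ c} ∩ Ioi 0 = Ioc 0 c.toReal := by
      ext t
      simp only [mem_inter_iff, mem_ofPred_eq, mem_Ioi, mem_Ioc, and_comm]
      rw [ENNReal.ofReal_le_iff_le_toReal hc]
    rw [this, Real.volume_Ioc, sub_zero, ENNReal.ofReal_toReal hc]

/-- Every nonzero `σ`-finite measure is the intensity of a Poisson process: writing `μ = f ν` with a
probability measure `ν`, it is the projection to `X` of the restriction of the marked Poisson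
process of intensity `dt ⊗ ν` to the region `t ≤ f x` below the graph of `f`. -/
theorem exists_isPoissonProcess {X : Type} [MeasurableSpace X] (μ : Measure X) [SigmaFinite μ]
    [NeZero μ] :
    ∃ (Ω : Type) (_ : MeasurableSpace Ω) (P : Measure Ω) (N : Ω → Measure X),
      IsPoissonProcess N μ P := by
  set f := μ.rnDeriv μ.toFinite with hf
  have hfm : Measurable f := Measure.measurable_rnDeriv _ _
  have hμ : μ.toFinite.withDensity f = μ :=
    Measure.withDensity_rnDeriv_eq _ _ (absolutelyContinuous_toFinite μ)
  have hA : MeasurableSet {p : ℝ × X | ENNReal.ofReal p.1 ≤ f p.2} :=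
    measurableSet_le (by fun_prop) (by fun_prop)
  have h := ((isPoissonProcess_markedPoint μ.toFinite).restrict hA).map measurable_snd
  have e : ((timeMeasure.prod μ.toFinite).restrict {p : ℝ × X | ENNReal.ofReal p.1 ≤ f p.2}).map
      Prod.snd = μ := by
    refine Eq.trans ?_ hμ
    ext B hB
    rw [Measure.map_apply measurable_snd hB, Measure.restrict_apply (measurable_snd hB),
      Measure.prod_apply_symm ((measurable_snd hB).inter hA), withDensity_apply _ hB,
      ← lintegral_indicator hB]
    refine lintegral_congr fun x => ?_
    by_cases hx : x ∈ B
    · rw [indicator_of_mem hx]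
      refine Eq.trans (congrArg timeMeasure ?_) (timeMeasure_setOf_le (f x))
      ext t
      simp [hx]
    · rw [indicator_of_notMem hx]
      refine Eq.trans (congrArg timeMeasure ?_) measure_empty
      ext t
      simp [hx]
  rw [e] at h
  exact ⟨_, _, _, _, h⟩

lemma timeMeasure_Iic (s : ℝ) : timeMeasure {t | t ≤ s} = ENNReal.ofReal s := by
  rw [timeMeasure, show {t : ℝ | t ≤ s} = Iic s from rfl, Measure.restrict_apply measurableSet_Iic,
    inter_comm, Ioi_inter_Iic, Real.volume_Ioc, sub_zero]

lemma map_snd_restrict_timeMeasure {X : Type} [MeasurableSpace X] (ν : Measure X) [SFinite ν]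
    (s : ℝ) :
    ((timeMeasure.prod ν).restrict {q | q.1 ≤ s}).map Prod.snd = ENNReal.ofReal s • ν := by
  have h := Measure.prod_restrict (μ := timeMeasure) (ν := ν) {t | t ≤ s} univ
  rw [Measure.restrict_univ] at h
  rw [show {q : ℝ × X | q.1 ≤ s} = {t | t ≤ s} ×ˢ univ by ext; simp, ← h, Measure.map_snd_prod,
    Measure.restrict_apply_univ, timeMeasure_Iic]

/-- The jumps up to time `s` of a Poisson process of jumps form a Poisson process. -/
lemma IsPoissonProcess.jumps {Ω : Type} [MeasurableSpace Ω] {N : Ω → Measure (ℝ × ℝ)}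
    {ν : Measure ℝ} [SFinite ν] {P : Measure Ω} (h : IsPoissonProcess N (timeMeasure.prod ν) P)
    (s : ℝ) : IsPoissonProcess (fun ω => jumps s (N ω)) (ENNReal.ofReal s • ν) P := by
  have h1 := (h.restrict (A := {q | q.1 ≤ s}) (measurableSet_le measurable_fst
    measurable_const)).map measurable_snd
  rwa [map_snd_restrict_timeMeasure] at h1

/-- The pairs `(Eᵢ / Pᵢ, Pᵢ)` with `Tᵢ ≤ 1` form a Poisson process. -/
lemma IsPoissonProcess.sizeBiasMarks {Ω : Type} [MeasurableSpace Ω] {M : Ω → Measure (ℝ × ℝ × ℝ)}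
    {ν : Measure (ℝ × ℝ)} [SFinite ν] {P : Measure Ω}
    (h : IsPoissonProcess M (timeMeasure.prod ν) P) :
    IsPoissonProcess (fun ω => sizeBiasMarks (M ω)) (ν.map fun q => (q.2 / q.1, q.1)) P := by
  have h1 := ((h.restrict (A := {q | q.1 ≤ 1}) (measurableSet_le measurable_fst
    measurable_const)).map measurable_snd).map (f := fun q => (q.2 / q.1, q.1)) (by fun_prop)
  rw [map_snd_restrict_timeMeasure, ENNReal.ofReal_one, one_smul] at h1
  convert! h1 using 2 with ω
  rw [Measure.map_map (by fun_prop) (by fun_prop)]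
  rfl

/-- The jumps of the gamma subordinator up to time `r` as a marked Poisson process: the image of
`dt ⊗ e^{-g} dg` under `(t, g) ↦ g e^{-t / r}` is `r x⁻¹ e^{-x} dx`. -/
lemma map_exp_mul_eq_gammaLevy {r : ℝ} (hr : 0 < r) :
    (timeMeasure.prod (gammaMeasure 1 1)).map (fun q => q.2 * Real.exp (-q.1 / r)) =
      ENNReal.ofReal r • gammaLevy := by
  have := isProbabilityMeasure_gammaMeasure one_pos one_pos
  refine Measure.ext_of_lintegral _ fun F hF => ?_
  rw [lintegral_map hF (by fun_prop), lintegral_prod_symm _ (by fun_prop), lintegral_smul_measure,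
    gammaLevy, lintegral_withDensity_eq_lintegral_mul _ (by fun_prop) hF,
    lintegral_gammaMeasure _ (Measurable.lintegral_prod_left' (f := fun q : ℝ × ℝ =>
      F (q.2 * Real.exp (-q.1 / r))) (by fun_prop)), timeMeasure]
  have e1 : ∀ g ∈ Ioi (0 : ℝ), ENNReal.ofReal ((Real.Gamma 1)⁻¹ * g ^ ((1 : ℝ) - 1) *
      Real.exp (-g)) * ∫⁻ t in Ioi 0, F (g * Real.exp (-t / r)) =
      ∫⁻ x in Ioo 0 g, ENNReal.ofReal (Real.exp (-g)) * (ENNReal.ofReal (r / x) * F x) := by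
    intro g hg
    rw [lintegral_Ioi_comp_exp_neg hr hg, lintegral_const_mul _ (by fun_prop)]
    simp
  rw [setLIntegral_congr_fun measurableSet_Ioi e1, ← lintegral_triangle_swap (by fun_prop),
    smul_eq_mul, ← lintegral_const_mul _ (by fun_prop)]
  refine setLIntegral_congr_fun measurableSet_Ioi fun x hx => ?_
  have hx : 0 < x := hx
  have hint : IntegrableOn (fun y => Real.exp (-y)) (Ioi x) := by
    simpa using integrableOn_exp_mul_Ioi (a := -1) (by norm_num) x
  simp only [Pi.mul_apply]
  rw [lintegral_mul_const _ (by fun_prop), ← ofReal_integral_eq_lintegral_ofReal hint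
    (ae_of_all _ fun y => (Real.exp_pos _).le), integral_exp_neg_Ioi, ← mul_assoc, ← mul_assoc,
    ← ENNReal.ofReal_mul (Real.exp_pos _).le, ← ENNReal.ofReal_mul hr.le]
  congr 2
  field_simp

/-- The stable jumps `p` marked with `z = e / p`, for an independent standard exponential `e`, as
a marked Poisson process: conditionally on the mark `z`, the jump is `g / z` with `g` of law
`gamma(1 - α)`. -/
lemma map_sizeBias_stableLevy {α : ℝ} (h0 : 0 < α) (h1 : α < 1) :
    ((stableLevy α).prod (expMeasure 1)).map (fun q => (q.2 / q.1, q.1)) =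
      (timeMeasure.prod (gammaMeasure (1 - α) 1)).map
        (fun q => (q.1 ^ α⁻¹, q.2 / q.1 ^ α⁻¹)) := by
  have := isProbabilityMeasure_gammaMeasure (sub_pos.2 h1) one_pos
  have hΓ : 0 < Real.Gamma (1 - α) := Real.Gamma_pos_of_pos (sub_pos.2 h1)
  refine Measure.ext_of_lintegral _ fun F hF => ?_
  rw [lintegral_map hF (by fun_prop), lintegral_map hF (by fun_prop),
    lintegral_prod _ (by fun_prop), lintegral_prod _ (by fun_prop), stableLevy,
    lintegral_withDensity_eq_lintegral_mul _ (by fun_prop) (Measurable.lintegral_prod_right'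
      (f := fun q : ℝ × ℝ => F (q.2 / q.1, q.1)) (by fun_prop)), timeMeasure]
  -- both sides have density `α / Γ(1 - α) p^{-α} e^{-p z}` with respect to `dz dp`
  have e1 : ∀ p ∈ Ioi (0 : ℝ), ((fun u => ENNReal.ofReal (α / Real.Gamma (1 - α) * u ^ (-(α + 1)))) *
      fun p => ∫⁻ e, F (e / p, p) ∂(expMeasure 1)) p = ∫⁻ z in Ioi 0,
      ENNReal.ofReal (α / Real.Gamma (1 - α) * p ^ (-α) * Real.exp (-(p * z))) * F (z, p) := by
    intro p hp
    have hp : 0 < p := hp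
    rw [Pi.mul_apply, lintegral_expMeasure (by fun_prop), lintegral_Ioi_comp_mul hp,
      ← lintegral_const_mul _ (by fun_prop)]
    refine setLIntegral_congr_fun measurableSet_Ioi fun z hz => ?_
    rw [mul_div_cancel_left₀ _ hp.ne', ← mul_assoc, ← mul_assoc, ← ENNReal.ofReal_mul (by positivity),
      ← ENNReal.ofReal_mul (by positivity)]
    congr 3
    rw [show -(α + 1) = -α - 1 by ring, Real.rpow_sub_one hp.ne']
    field_simp
  have e2 : ∀ z ∈ Ioi (0 : ℝ), ENNReal.ofReal (α * z ^ (α - 1)) *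
      ∫⁻ g, F ((z ^ α) ^ α⁻¹, g / (z ^ α) ^ α⁻¹) ∂(gammaMeasure (1 - α) 1) = ∫⁻ p in Ioi 0,
      ENNReal.ofReal (α / Real.Gamma (1 - α) * p ^ (-α) * Real.exp (-(p * z))) * F (z, p) := by
    intro z hz
    have hz : 0 < z := hz
    rw [Real.rpow_rpow_inv hz.le h0.ne', lintegral_gammaMeasure _ (by fun_prop),
      lintegral_Ioi_comp_mul hz, ← lintegral_const_mul _ (by fun_prop)]
    refine setLIntegral_congr_fun measurableSet_Ioi fun p hp => ?_
    have hp : 0 < p := hp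
    rw [mul_div_cancel_left₀ _ hz.ne', ← mul_assoc, ← mul_assoc, ← ENNReal.ofReal_mul (by positivity),
      ← ENNReal.ofReal_mul (by positivity)]
    congr 2
    rw [show 1 - α - 1 = -α by ring, Real.mul_rpow hz.le hp.le, Real.rpow_sub_one hz.ne',
      Real.rpow_neg hz.le, mul_comm z p]
    have := (Real.rpow_pos_of_pos hz α).ne'
    field_simp
  rw [setLIntegral_congr_fun measurableSet_Ioi e1, lintegral_Ioi_comp_rpow h0 (fun t =>
    ∫⁻ g, F (t ^ α⁻¹, g / t ^ α⁻¹) ∂(gammaMeasure (1 - α) 1)),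
    setLIntegral_congr_fun measurableSet_Ioi e2,
    lintegral_lintegral_swap (by fun_prop)]

/-! ### Beta-gamma algebra -/

lemma lintegral_betaMeasure (a b : ℝ) {f : ℝ → ℝ≥0∞} (hf : Measurable f) :
    ∫⁻ x, f x ∂(betaMeasure a b) = ∫⁻ x in Ioo 0 1,
      ENNReal.ofReal ((beta a b)⁻¹ * x ^ (a - 1) * (1 - x) ^ (b - 1)) * f x := by
  have hm : Measurable (betaPDF a b) := (measurable_betaPDFReal a b).ennreal_ofReal
  rw [betaMeasure, lintegral_withDensity_eq_lintegral_mul _ hm hf,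
    ← lintegral_indicator measurableSet_Ioo]
  refine lintegral_congr fun x => ?_
  rw [Pi.mul_apply, betaPDF_eq]
  by_cases hx : x ∈ Ioo (0 : ℝ) 1
  · rw [indicator_of_mem hx, if_pos (mem_Ioo.1 hx), one_div]
  · rw [indicator_of_notMem hx, if_neg (fun h => hx (mem_Ioo.2 h)), ENNReal.ofReal_zero, zero_mul]

lemma ae_mem_Ioo_betaMeasure (a b : ℝ) : ∀ᵐ x ∂(betaMeasure a b), x ∈ Ioo (0 : ℝ) 1 := by
  have h := lintegral_betaMeasure a b (f := (Ioo (0 : ℝ) 1)ᶜ.indicator 1)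
    (measurable_one.indicator measurableSet_Ioo.compl)
  rw [lintegral_indicator_one measurableSet_Ioo.compl, setLIntegral_congr_fun (g := fun _ => 0)
    measurableSet_Ioo fun x hx => by simp [hx]] at h
  rw [lintegral_zero] at h
  exact h

lemma lintegral_Ioi_shift (x : ℝ) (f : ℝ → ℝ≥0∞) :
    ∫⁻ z in Ioi 0, f z = ∫⁻ s in Ioi x, f (s - x) := by
  have h := lintegral_image_eq_lintegral_abs_deriv_mul (f := fun s => s - x) (f' := fun _ => 1)
    (measurableSet_Ioi (a := x)) (fun z _ => ((hasDerivAt_id z).sub_const x).hasDerivWithinAt)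
    (sub_left_injective).injOn f
  simpa using h

variable {a b : ℝ}

/-- If `Y ∼ beta(a, b)` and `S ∼ gamma(a + b)` are independent, then `Y S ∼ gamma(a)` and
`(1 - Y) S ∼ gamma(b)` are independent. -/
lemma measurePreserving_beta_gamma (ha : 0 < a) (hb : 0 < b) :
    MeasurePreserving (fun p : ℝ × ℝ => (p.1 * p.2, (1 - p.1) * p.2))
      ((betaMeasure a b).prod (gammaMeasure (a + b) 1))
      ((gammaMeasure a 1).prod (gammaMeasure b 1)) := by
  have := isProbabilityMeasure_gammaMeasure ha one_pos
  have := isProbabilityMeasure_gammaMeasure hb one_pos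
  have := isProbabilityMeasure_gammaMeasure (add_pos ha hb) one_pos
  have := isProbabilityMeasureBeta ha hb
  have hΓa := Real.Gamma_pos_of_pos ha
  have hΓb := Real.Gamma_pos_of_pos hb
  have hΓ := Real.Gamma_pos_of_pos (add_pos ha hb)
  refine ⟨by fun_prop, Measure.ext_of_lintegral _ fun F hF => ?_⟩
  rw [lintegral_map hF (by fun_prop), lintegral_prod_symm _ (by fun_prop),
    lintegral_prod _ (by fun_prop),
    lintegral_gammaMeasure _ (Measurable.lintegral_prod_left' (f := fun q : ℝ × ℝ =>
      F (q.1 * q.2, (1 - q.1) * q.2)) (by fun_prop)),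
    lintegral_gammaMeasure _ (Measurable.lintegral_prod_right' hF)]
  let w : ℝ → ℝ → ℝ := fun c x => (Real.Gamma c)⁻¹ * x ^ (c - 1) * Real.exp (-x)
  have hw : ∀ c, Measurable (w c) := fun c => by fun_prop
  have e1 : ∀ x ∈ Ioi (0 : ℝ), ENNReal.ofReal (w a x) * ∫⁻ z, F (x, z) ∂(gammaMeasure b 1) =
      ∫⁻ s in Ioi x, ENNReal.ofReal (w a x) * (ENNReal.ofReal (w b (s - x)) * F (x, s - x)) := by
    intro x _
    rw [lintegral_const_mul _ (by fun_prop), lintegral_gammaMeasure _ (by fun_prop),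
      lintegral_Ioi_shift x]
  rw [setLIntegral_congr_fun measurableSet_Ioi e1, lintegral_triangle_swap (by fun_prop)]
  refine setLIntegral_congr_fun measurableSet_Ioi fun s hs => ?_
  have hs : 0 < s := hs
  rw [lintegral_Ioo_comp_mul hs, lintegral_betaMeasure _ _ (by fun_prop),
    ← lintegral_const_mul _ (by fun_prop)]
  refine setLIntegral_congr_fun measurableSet_Ioo fun y hy => ?_
  have hy0 : 0 < y := hy.1
  have hy1 : 0 < 1 - y := sub_pos.2 hy.2
  have hwa : 0 ≤ w a (s * y) := by positivity
  have hβ := (beta_pos ha hb).le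
  have hpt : (y * s, (1 - y) * s) = (s * y, s - s * y) := by
    ext <;> simp <;> ring
  simp only
  rw [hpt, ← mul_assoc, ← mul_assoc, ← mul_assoc, ← ENNReal.ofReal_mul (by positivity),
    ← ENNReal.ofReal_mul hs.le, ← ENNReal.ofReal_mul (by positivity)]
  congr 2
  simp only [w, beta]
  rw [show s - s * y = s * (1 - y) by ring, Real.mul_rpow hs.le hy0.le,
    Real.mul_rpow hs.le hy1.le, show a + b - 1 = (a - 1) + (b - 1) + 1 by ring,
    Real.rpow_add hs, Real.rpow_add hs, Real.rpow_one,
    show Real.exp (-s) = Real.exp (-(s * y)) * Real.exp (-(s * (1 - y))) by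
      rw [← Real.exp_add]; ring_nf]
  field_simp

/-- If `S ∼ gamma(a)` and `X ∼ gamma(b)` are independent, then `S / (S + X) ∼ beta(a, b)` and
`S + X ∼ gamma(a + b)` are independent. -/
lemma measurePreserving_gamma_ratio (ha : 0 < a) (hb : 0 < b) :
    MeasurePreserving (fun p : ℝ × ℝ => (p.1 / (p.1 + p.2), p.1 + p.2))
      ((gammaMeasure a 1).prod (gammaMeasure b 1))
      ((betaMeasure a b).prod (gammaMeasure (a + b) 1)) := by
  have := isProbabilityMeasure_gammaMeasure (add_pos ha hb) one_pos
  have := isProbabilityMeasureBeta ha hb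
  refine ⟨by fun_prop, ?_⟩
  rw [← (measurePreserving_beta_gamma ha hb).map_eq, Measure.map_map (by fun_prop) (by fun_prop)]
  have hs := (Measure.quasiMeasurePreserving_snd (μ := betaMeasure a b)
    (ν := gammaMeasure (a + b) 1)).ae (ae_pos_gammaMeasure (a + b))
  conv_rhs => rw [← Measure.map_id (μ := (betaMeasure a b).prod (gammaMeasure (a + b) 1))]
  refine Measure.map_congr ?_
  filter_upwards [hs] with p hp
  have e : p.1 * p.2 + (1 - p.1) * p.2 = p.2 := by ring
  simp only [Function.comp, e, id]
  rw [mul_div_cancel_right₀ _ hp.ne']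

lemma beta_one_right (hb : 0 < b) : beta b 1 = b⁻¹ := by
  rw [beta, Real.Gamma_one, Real.Gamma_add_one hb.ne', mul_one, div_mul_cancel_right₀
    (Real.Gamma_pos_of_pos hb).ne']

/-- If `X ∼ beta(b, 1)` then `X^{1/a} ∼ beta(a b, 1)`. -/
lemma map_rpow_betaMeasure (ha : 0 < a) (hb : 0 < b) :
    (betaMeasure b 1).map (fun x => x ^ a⁻¹) = betaMeasure (a * b) 1 := by
  refine Measure.ext_of_lintegral _ fun F hF => ?_
  rw [lintegral_map hF (by fun_prop), lintegral_betaMeasure _ _ (by fun_prop),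
    lintegral_betaMeasure _ _ hF, beta_one_right hb, beta_one_right (mul_pos ha hb)]
  have e : ∀ f : ℝ → ℝ≥0∞, ∫⁻ x in Ioo 0 1, f x = ∫⁻ x in Ioi 0, (Iio 1).indicator f x := by
    intro f
    rw [lintegral_indicator measurableSet_Iio, Measure.restrict_restrict measurableSet_Iio,
      Iio_inter_Ioi]
  rw [e, e, lintegral_Ioi_comp_rpow ha]
  refine setLIntegral_congr_fun measurableSet_Ioi fun z hz => ?_
  have hz : 0 < z := hz
  by_cases h1 : z < 1
  · rw [indicator_of_mem (show z ^ a ∈ Iio 1 from Real.rpow_lt_one hz.le h1 ha),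
      indicator_of_mem (show z ∈ Iio 1 from h1), ← mul_assoc,
      ← ENNReal.ofReal_mul (by positivity), Real.rpow_rpow_inv hz.le ha.ne']
    congr 2
    rw [sub_self, Real.rpow_zero, Real.rpow_zero, ← Real.rpow_mul hz.le,
      show a * b - 1 = (a - 1) + a * (b - 1) by ring, Real.rpow_add hz]
    simp only [inv_inv]
    ring
  · rw [indicator_of_notMem (by simpa using Real.one_le_rpow (not_lt.1 h1) ha.le),
      indicator_of_notMem (by simpa using h1), mul_zero]

/-- If `X` is standard exponential then `e^{-X/a} ∼ beta(a, 1)`. -/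
lemma map_exp_neg_expMeasure (ha : 0 < a) :
    (expMeasure 1).map (fun x => Real.exp (-x / a)) = betaMeasure a 1 := by
  refine Measure.ext_of_lintegral _ fun F hF => ?_
  rw [lintegral_map hF (by fun_prop), lintegral_betaMeasure _ _ hF, lintegral_expMeasure
    (by fun_prop), beta_one_right ha]
  have h := lintegral_Ioi_comp_exp_neg ha one_pos fun y => ENNReal.ofReal (y ^ a) * F y
  simp only [one_mul, ← Real.exp_mul, div_mul_cancel₀ _ ha.ne'] at h
  rw [h]
  refine setLIntegral_congr_fun measurableSet_Ioo fun y hy => ?_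
  have hy0 : 0 < y := hy.1
  rw [← mul_assoc, ← ENNReal.ofReal_mul (by positivity)]
  congr 2
  rw [sub_self, Real.rpow_zero, Real.rpow_sub_one hy0.ne', inv_inv]
  field_simp

section Rearrange

variable {A B C D E : Type*} [MeasurableSpace A] [MeasurableSpace B] [MeasurableSpace C]
  [MeasurableSpace D] [MeasurableSpace E] {μA : Measure A} {μB : Measure B} {μC : Measure C}
  {μD : Measure D} {μE : Measure E} [IsProbabilityMeasure μA] [IsProbabilityMeasure μB]
  [IsProbabilityMeasure μC] [IsProbabilityMeasure μD] [IsProbabilityMeasure μE]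

/-- Carrying along an independent mark. -/
lemma MeasurePreserving.prod_mark {f : A × B → C × D}
    (hf : MeasurePreserving f (μA.prod μB) (μC.prod μD)) :
    MeasurePreserving (fun p : A × (B × E) => ((p.2.2, (f (p.1, p.2.1)).1), (f (p.1, p.2.1)).2))
      (μA.prod (μB.prod μE)) ((μE.prod μC).prod μD) :=
  (((measurePreserving_prodAssoc μE μC μD).symm.comp Measure.measurePreserving_swap).comp
    (hf.prod (MeasurePreserving.id μE))).comp (measurePreserving_prodAssoc μA μB μE).symm

end Rearrange

/-- One step of the stick-breaking recursion: from independent `S ∼ gamma(a + b)`,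
`Y ∼ beta(a, b)` and `X ∼ gamma(c)`, one obtains independent `Y S ∼ gamma(a)`,
`(1 - Y) S / S' ∼ beta(b, c)` and `S' = (1 - Y) S + X ∼ gamma(b + c)`. -/
lemma measurePreserving_stick {c : ℝ} (ha : 0 < a) (hb : 0 < b) (hc : 0 < c) :
    MeasurePreserving (fun p : ℝ × (ℝ × ℝ) =>
        ((p.2.1 * p.1, (1 - p.2.1) * p.1 / ((1 - p.2.1) * p.1 + p.2.2)),
          (1 - p.2.1) * p.1 + p.2.2))
      ((gammaMeasure (a + b) 1).prod ((betaMeasure a b).prod (gammaMeasure c 1)))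
      (((gammaMeasure a 1).prod (betaMeasure b c)).prod (gammaMeasure (b + c) 1)) := by
  have := isProbabilityMeasure_gammaMeasure ha one_pos
  have := isProbabilityMeasure_gammaMeasure hb one_pos
  have := isProbabilityMeasure_gammaMeasure hc one_pos
  have := isProbabilityMeasure_gammaMeasure (add_pos ha hb) one_pos
  have := isProbabilityMeasure_gammaMeasure (add_pos hb hc) one_pos
  have := isProbabilityMeasureBeta ha hb
  have := isProbabilityMeasureBeta hb hc
  have m1 := (measurePreserving_prodAssoc (gammaMeasure (a + b) 1) (betaMeasure a b)
    (gammaMeasure c 1)).symm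
  have m2 := (((measurePreserving_beta_gamma ha hb).comp
    Measure.measurePreserving_swap).prod (MeasurePreserving.id (gammaMeasure c 1))).comp m1
  have m3 := (measurePreserving_prodAssoc (gammaMeasure a 1) (gammaMeasure b 1)
    (gammaMeasure c 1)).comp m2
  have m4 := ((MeasurePreserving.id (gammaMeasure a 1)).prod
    (measurePreserving_gamma_ratio hb hc)).comp m3
  exact (measurePreserving_prodAssoc (gammaMeasure a 1) (betaMeasure b c)
    (gammaMeasure (b + c) 1)).symm.comp m4

/-! ### Measurability of the self-normalization and of the first mark -/

/-- The sum of the points of a counting measure on `(0, ∞)`. -/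
def totalMass (m : Measure ℝ) : ℝ≥0∞ := ∫⁻ x, ENNReal.ofReal x ∂m

@[fun_prop]
lemma measurable_totalMass : Measurable totalMass := Measure.measurable_lintegral (by fun_prop)

/-- The measures on `(0, ∞)` whose sum of points is positive and finite: those on which the
self-normalization is meaningful. -/
def normalizable : Set (Measure ℝ) :=
  {m | m (Iic 0) = 0 ∧ totalMass m ≠ 0 ∧ totalMass m ≠ ∞}

lemma measurableSet_normalizable : MeasurableSet normalizable := by
  refine MeasurableSet.inter ?_ (MeasurableSet.inter ?_ ?_)
  · exact Measure.measurable_coe measurableSet_Iic (measurableSet_singleton 0)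
  · exact (measurable_totalMass (measurableSet_singleton 0)).compl
  · exact (measurable_totalMass (measurableSet_singleton ∞)).compl

lemma ae_pos_of_mem_normalizable {m : Measure ℝ} (hm : m ∈ normalizable) : ∀ᵐ x ∂m, 0 < x := by
  have := hm.1
  rw [ae_iff]
  simpa [Iic] using this

lemma integral_eq_totalMass {m : Measure ℝ} (hm : m ∈ normalizable) :
    ∫ y, y ∂m = (totalMass m).toReal :=
  integral_eq_lintegral_of_nonneg_ae
    ((ae_pos_of_mem_normalizable hm).mono fun _ hx => le_of_lt hx) (by fun_prop)

lemma withDensity_univ_eq_totalMass (m : Measure ℝ) :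
    m.withDensity (fun x => ENNReal.ofReal x) univ = totalMass m := by
  rw [withDensity_apply _ MeasurableSet.univ, Measure.restrict_univ, totalMass]

open Classical in
/-- The size-biased pick from a normalizable counting measure, as a Markov kernel. -/
def sizeBiasedKernel : Kernel (Measure ℝ) ℝ where
  toFun m := if m ∈ normalizable then
    (totalMass m)⁻¹ • m.withDensity (fun x => ENNReal.ofReal x) else Measure.dirac 0
  measurable' := by
    refine Measurable.ite measurableSet_normalizable ?_ measurable_const
    refine Measure.measurable_of_measurable_coe _ fun s hs => ?_
    simp only [Measure.smul_apply, withDensity_apply _ hs, smul_eq_mul, ← lintegral_indicator hs]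
    have : Measurable fun x => s.indicator (fun x => ENNReal.ofReal x) x :=
      Measurable.indicator (by fun_prop) hs
    exact measurable_totalMass.inv.mul (Measure.measurable_lintegral this)

lemma sizeBiasedKernel_of_mem {m : Measure ℝ} (hm : m ∈ normalizable) :
    sizeBiasedKernel m = (totalMass m)⁻¹ • m.withDensity (fun x => ENNReal.ofReal x) :=
  if_pos hm

instance : IsMarkovKernel sizeBiasedKernel := ⟨fun m => by
  by_cases hm : m ∈ normalizable
  · rw [sizeBiasedKernel_of_mem hm]
    refine ⟨?_⟩
    rw [Measure.smul_apply, withDensity_univ_eq_totalMass, smul_eq_mul,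
      ENNReal.inv_mul_cancel hm.2.1 hm.2.2]
  · have : sizeBiasedKernel m = Measure.dirac 0 := if_neg hm
    rw [this]
    infer_instance⟩

/-- Reconstruction of the normalized measure from the size-biased pick. Integration against the
kernel, unlike integration against a general measure, is jointly measurable. -/
lemma selfNormalize_apply {m : Measure ℝ} (hm : m ∈ normalizable) {B : Set ℝ}
    (hB : MeasurableSet B) :
    selfNormalize m B = totalMass m * ∫⁻ x, B.indicator 1 (x / (totalMass m).toReal) *
      (ENNReal.ofReal x)⁻¹ ∂(sizeBiasedKernel m) := by
  have h1 : Measurable fun x => B.indicator (1 : ℝ → ℝ≥0∞) (x / (totalMass m).toReal) :=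
    (measurable_one.indicator hB).comp (measurable_id.div_const _)
  rw [sizeBiasedKernel_of_mem hm, lintegral_smul_measure, smul_eq_mul, ← mul_assoc,
    ENNReal.mul_inv_cancel hm.2.1 hm.2.2, one_mul, lintegral_withDensity_eq_lintegral_mul _
      (by fun_prop) (by fun_prop), selfNormalize, integral_eq_totalMass hm,
    ← lintegral_indicator_one hB, lintegral_map (measurable_one.indicator hB)
      (by fun_prop)]
  refine lintegral_congr_ae ((ae_pos_of_mem_normalizable hm).mono fun x hx => ?_)
  have hx' : ENNReal.ofReal x ≠ 0 := by simpa using hx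
  simp only [Pi.mul_apply]
  rw [mul_comm, mul_assoc, ENNReal.inv_mul_cancel hx' ENNReal.ofReal_ne_top, mul_one]

/-- Self-normalization is measurable up to a null set as soon as the random measure is almost surely
normalizable. -/
lemma aemeasurable_selfNormalize {Q : Measure (Measure ℝ)} (hQ : ∀ᵐ m ∂Q, m ∈ normalizable) :
    AEMeasurable selfNormalize Q := by
  classical
  refine ⟨fun m => if m ∈ normalizable then selfNormalize m else 0, ?_,
    hQ.mono fun m hm => (if_pos hm).symm⟩
  refine Measure.measurable_of_measurable_coe _ fun B hB => ?_
  have h1 : Measurable fun p : Measure ℝ × ℝ =>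
      B.indicator (1 : ℝ → ℝ≥0∞) (p.2 / (totalMass p.1).toReal) * (ENNReal.ofReal p.2)⁻¹ := by
    refine Measurable.mul ((measurable_one.indicator hB).comp ?_) (by fun_prop)
    exact measurable_snd.div (measurable_totalMass.comp measurable_fst).ennreal_toReal
  have h2 := measurable_totalMass.mul (Measurable.lintegral_kernel_prod_right'
    (κ := sizeBiasedKernel) h1)
  have h3 := h2.indicator measurableSet_normalizable
  convert! h3 using 1
  funext m
  by_cases hm : m ∈ normalizable
  · rw [if_pos hm, indicator_of_mem hm, selfNormalize_apply hm hB]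
    rfl
  · rw [if_neg hm, indicator_of_notMem hm, Measure.coe_zero, Pi.zero_apply]

lemma measurable_pointMeasure {Ω : Type*} [MeasurableSpace Ω] {x : Ω → ℕ → ℝ} (hx : Measurable x) :
    Measurable fun ω => pointMeasure (x ω) := by
  refine Measure.measurable_of_measurable_coe _ fun s hs => ?_
  simp only [pointMeasure, Measure.sum_apply _ hs]
  exact Measurable.tsum fun n => (Measure.measurable_coe hs).comp
    (Measure.measurable_dirac.comp ((measurable_pi_apply n).comp hx))

lemma totalMass_pointMeasure {x : ℕ → ℝ} (h0 : ∀ n, 0 < x n) (hs : Summable x) :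
    totalMass (pointMeasure x) = ENNReal.ofReal (∑' n, x n) := by
  rw [totalMass, pointMeasure, lintegral_sum_measure,
    ENNReal.ofReal_tsum_of_nonneg (fun n => (h0 n).le) hs]
  simp

lemma pointMeasure_mem_normalizable {x : ℕ → ℝ} (h0 : ∀ n, 0 < x n) (hs : Summable x) :
    pointMeasure x ∈ normalizable := by
  refine ⟨?_, ?_, ?_⟩
  · rw [pointMeasure, Measure.sum_apply _ measurableSet_Iic]
    simp [h0]
  · rw [totalMass_pointMeasure h0 hs]
    simpa using hs.tsum_pos (fun n => (h0 n).le) 0 (h0 0)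
  · rw [totalMass_pointMeasure h0 hs]
    exact ENNReal.ofReal_ne_top

lemma map_pointMeasure (x : ℕ → ℝ) {f : ℝ → ℝ} (hf : Measurable f) :
    (pointMeasure x).map f = pointMeasure fun n => f (x n) := by
  rw [pointMeasure, Measure.map_sum hf.aemeasurable, pointMeasure]
  simp_rw [Measure.map_dirac' hf]

lemma selfNormalize_pointMeasure {x : ℕ → ℝ} (h0 : ∀ n, 0 < x n) (hs : Summable x) :
    selfNormalize (pointMeasure x) = pointMeasure (normalizeSeq x) := by
  rw [selfNormalize, integral_eq_totalMass (pointMeasure_mem_normalizable h0 hs),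
    totalMass_pointMeasure h0 hs, ENNReal.toReal_ofReal (tsum_nonneg fun n => (h0 n).le),
    map_pointMeasure _ (by fun_prop)]
  rfl

lemma normalizeSeq_const_mul {c : ℝ} (hc : c ≠ 0) (x : ℕ → ℝ) :
    normalizeSeq (fun n => c * x n) = normalizeSeq x := by
  funext n
  rw [normalizeSeq, normalizeSeq, tsum_mul_left, mul_div_mul_left _ _ hc]

lemma measurable_firstMark : Measurable firstMark := by
  let E : ℝ → Set (Measure (ℝ × ℝ)) := fun z => {m | m {q | q.1 ≤ z} ≠ 0}
  have hE : ∀ z, MeasurableSet (E z) := fun z =>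
    (Measure.measurable_coe (measurableSet_le measurable_fst measurable_const)
      (measurableSet_singleton 0)).compl
  have hmono : ∀ {m : Measure (ℝ × ℝ)} {z z' : ℝ}, z ≤ z' → m ∈ E z → m ∈ E z' :=
    fun {m z z'} hz hm h0 => hm (measure_mono_null (fun q hq => le_trans hq hz) h0)
  -- the infimum is the junk value `0` exactly for measures in `A`
  let A : Set (Measure (ℝ × ℝ)) := (⋂ n : ℕ, (E (n : ℝ))ᶜ) ∪ ⋂ n : ℕ, E (-(n : ℝ))
  have hA : MeasurableSet A := (MeasurableSet.iInter fun n : ℕ => (hE (n : ℝ)).compl).union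
    (MeasurableSet.iInter fun n : ℕ => hE (-(n : ℝ)))
  have hfA : ∀ m ∈ A, firstMark m = 0 := by
    rintro m (h | h)
    · have : {z : ℝ | m {q | q.1 ≤ z} ≠ 0} = ∅ := by
        refine eq_empty_of_forall_notMem fun z hz => ?_
        obtain ⟨n, hn⟩ := exists_nat_ge z
        exact mem_iInter.1 h n (hmono hn hz)
      rw [firstMark, this, Real.sInf_empty]
    · refine Real.sInf_of_not_bddBelow fun ⟨b, hb⟩ => ?_
      obtain ⟨n, hn⟩ := exists_nat_gt (-b)
      have := hb (mem_iInter.1 h n)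
      linarith
  have hfA' : ∀ m ∉ A, ∀ t, firstMark m < t ↔ ∃ q : ℚ, (q : ℝ) < t ∧ m ∈ E q := by
    intro m hm t
    have hne : {z : ℝ | m {q | q.1 ≤ z} ≠ 0}.Nonempty := by
      by_contra hemp
      rw [not_nonempty_iff_eq_empty] at hemp
      refine hm (Or.inl (mem_iInter.2 fun n hn => ?_))
      have : (n : ℝ) ∈ {z : ℝ | m {q | q.1 ≤ z} ≠ 0} := hn
      rw [hemp] at this
      exact this
    have hbdd : BddBelow {z : ℝ | m {q | q.1 ≤ z} ≠ 0} := by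
      by_contra hb
      refine hm (Or.inr (mem_iInter.2 fun n => ?_))
      rw [not_bddBelow_iff] at hb
      obtain ⟨z, hz, hzn⟩ := hb (-n)
      exact hmono hzn.le hz
    rw [firstMark, csInf_lt_iff hbdd hne]
    constructor
    · rintro ⟨z, hz, hzt⟩
      obtain ⟨q, hq1, hq2⟩ := exists_rat_btwn hzt
      exact ⟨q, hq2, hmono hq1.le hz⟩
    · rintro ⟨q, hqt, hq⟩
      exact ⟨q, hq, hqt⟩
  refine measurable_of_Iio fun t => ?_
  have : firstMark ⁻¹' Iio t = (A ∩ {_m | 0 < t}) ∪ (Aᶜ ∩ ⋃ q : ℚ, {m | (q : ℝ) < t ∧ m ∈ E q}) := by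
    ext m
    by_cases hm : m ∈ A
    · simp [hm, hfA m hm]
    · simp [hm, hfA' m hm t]
  rw [this]
  refine (hA.inter (MeasurableSet.const _)).union (hA.compl.inter (MeasurableSet.iUnion fun q => ?_))
  exact (MeasurableSet.const _).inter (hE q)

lemma firstMark_sum_dirac {z p : ℕ → ℝ} (hz : StrictMono z) :
    firstMark (Measure.sum fun n => Measure.dirac (z n, p n)) = z 0 := by
  have : {t : ℝ | (Measure.sum fun n => Measure.dirac (z n, p n)) {q : ℝ × ℝ | q.1 ≤ t} ≠ 0} =
      Ici (z 0) := by
    ext t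
    have hm : MeasurableSet {q : ℝ × ℝ | q.1 ≤ t} :=
      measurableSet_le measurable_fst measurable_const
    simp only [mem_ofPred_eq, mem_Ici, ne_eq, Measure.sum_apply _ hm, ENNReal.tsum_eq_zero, not_forall]
    constructor
    · rintro ⟨n, hn⟩
      by_contra ht
      refine hn ?_
      have : ¬ z n ≤ t := fun h => ht ((hz.monotone n.zero_le).trans h)
      simp [Measure.dirac_apply' _ hm, this]
    · intro ht
      refine ⟨0, ?_⟩
      simp [Measure.dirac_apply' _ hm, ht]
  rw [firstMark, this, csInf_Ici]

/-! ### Residual allocation models and stick-breaking -/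

/-- The law of the independent sequence `(Gₙ, Uₙ)` with `Gₙ ∼ gamma(c)` and
`Uₙ ∼ beta(a₁ + n α, c + α)`, which defines the residual allocation model. -/
def ramLaw (α a₁ c : ℝ) : Measure (ℕ → ℝ × ℝ) :=
  Measure.infinitePi fun n : ℕ => (gammaMeasure c 1).prod (betaMeasure (a₁ + n * α) (c + α))

/-- The sequence `Gₙ Πₙ` as a function of `(Gₙ, Uₙ)ₙ`. -/
def ramTerms (w : ℕ → ℝ × ℝ) : ℕ → ℝ :=
  perpetuityTerms (fun n => (w n).1) fun n => (w n).2

/-- The mass-partition of the residual allocation model as a function of `(Gₙ, Uₙ)ₙ`. -/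
def ramPartition (w : ℕ → ℝ × ℝ) : Measure ℝ := pointMeasure (normalizeSeq (ramTerms w))

lemma measurable_ramTerms : Measurable ramTerms := by
  refine measurable_pi_lambda _ fun n => ?_
  unfold ramTerms perpetuityTerms
  fun_prop

lemma measurable_ramPartition : Measurable ramPartition := by
  refine measurable_pointMeasure (measurable_pi_lambda _ fun n => ?_)
  have h : ∀ k, Measurable fun w => ramTerms w k := fun k =>
    (measurable_pi_apply k).comp measurable_ramTerms
  unfold normalizeSeq
  exact (h n).div (Measurable.tsum h)

lemma iIndepFun_of_map_eq_infinitePi {Ω E : Type*} [MeasurableSpace Ω] [MeasurableSpace E]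
    {P : Measure Ω} [IsProbabilityMeasure P] {X : ℕ → Ω → E} (hX : ∀ n, Measurable (X n))
    {rho : ℕ → Measure E} [∀ n, IsProbabilityMeasure (rho n)]
    (h : P.map (fun ω n => X n ω) = Measure.infinitePi rho) :
    iIndepFun X P ∧ ∀ n, P.map (X n) = rho n := by
  have h1 : ∀ n, P.map (X n) = rho n := fun n => by
    rw [← Measure.infinitePi_map_eval rho n, ← h, Measure.map_map (by fun_prop) (by fun_prop)]
    rfl
  refine ⟨?_, h1⟩
  rw [iIndepFun_iff_map_fun_eq_infinitePi_map hX, h]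
  simp_rw [h1]

/-- Independent pairs of independent variables form a single independent family. -/
lemma iIndepFun_sumElim {Ω : Type*} [MeasurableSpace Ω] {P : Measure Ω} {X Y : ℕ → Ω → ℝ}
    (hX : ∀ n, Measurable (X n)) (hY : ∀ n, Measurable (Y n))
    (h1 : iIndepFun (fun n ω => (X n ω, Y n ω)) P) (h2 : ∀ n, IndepFun (X n) (Y n) P) :
    iIndepFun (Sum.elim X Y) P := by
  have := h1.isProbabilityMeasure
  let Z : ℕ → Bool → Ω → ℝ := fun n b => bif b then X n else Y n
  have hZ : ∀ n b, Measurable (Z n b) := by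
    rintro n (_ | _)
    · exact hY n
    · exact hX n
  have hZ1 : iIndepFun (fun n ω => (Z n · ω)) P := by
    have h := h1.comp (fun _ p b => bif b then p.1 else p.2) fun n =>
      measurable_pi_lambda _ fun b => by cases b <;> simp <;> fun_prop
    convert! h using 3 with n ω
    funext b
    cases b <;> rfl
  have hZ2 : ∀ n, iIndepFun (Z n) P := by
    intro n
    rw [iIndepFun_iff_measure_inter_preimage_eq_mul]
    intro S t ht
    by_cases hS : S = Finset.univ
    · subst hS
      have h := (h2 n).measure_inter_preimage_eq_mul _ _ (ht true (by simp)) (ht false (by simp))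
      have e : (⋂ b, Z n b ⁻¹' t b) = X n ⁻¹' t true ∩ Y n ⁻¹' t false := by
        ext ω
        simp [Z]
        tauto
      simp only [Finset.mem_univ, iInter_true, e, Fintype.prod_bool]
      exact h
    · have hS : S = ∅ ∨ S = {true} ∨ S = {false} := by
        revert hS
        clear ht
        revert S
        decide
      rcases hS with rfl | rfl | rfl <;> simp
  have h3 := (iIndepFun_uncurry' hZ hZ1 hZ2).precomp
    (g := Sum.elim (fun n => (n, true)) fun n => (n, false)) (by
      rintro (i | i) (j | j) hij <;> simp_all)
  convert! h3 using 1
  funext i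
  cases i <;> rfl

/-- If `Y ∼ beta(a, b)` then `E(1 - Y) = b / (a + b)`. -/
lemma lintegral_one_sub_betaMeasure {a b : ℝ} (ha : 0 < a) (hb : 0 < b) :
    ∫⁻ y, ENNReal.ofReal (1 - y) ∂(betaMeasure a b) = ENNReal.ofReal (b / (a + b)) := by
  have := isProbabilityMeasureBeta ha (add_pos hb one_pos)
  have h := lintegral_betaMeasure a (b + 1) (f := fun _ => 1) measurable_const
  rw [lintegral_const, measure_univ, one_mul] at h
  rw [lintegral_betaMeasure _ _ (by fun_prop), ← mul_one (ENNReal.ofReal (b / (a + b))), h,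
    ← lintegral_const_mul _ (by fun_prop)]
  refine setLIntegral_congr_fun measurableSet_Ioo fun y hy => ?_
  have hy0 : 0 < y := hy.1
  have hy1 : 0 < 1 - y := sub_pos.2 hy.2
  have hβ := (beta_pos ha hb).le
  rw [mul_one, ← ENNReal.ofReal_mul (by positivity), ← ENNReal.ofReal_mul (by positivity)]
  congr 1
  have hΓa := Real.Gamma_pos_of_pos ha
  have hΓb := Real.Gamma_pos_of_pos hb
  have hΓ := Real.Gamma_pos_of_pos (add_pos ha hb)
  rw [beta, beta, ← add_assoc, Real.Gamma_add_one hb.ne', Real.Gamma_add_one (add_pos ha hb).ne',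
    add_sub_cancel_right, Real.rpow_sub_one hy1.ne']
  field_simp

section Stick

variable {α a₁ c : ℝ}

/-- The mean length of the remaining stick tends to zero, by divergence of the harmonic series. -/
lemma tendsto_prod_beta_mean (hα : 0 ≤ α) (ha : 0 < a₁) (hc : 0 < c) :
    Tendsto (fun n => ∏ i ∈ Finset.range n, ((a₁ + i * α) / (c + (a₁ + i * α)))) atTop (𝓝 0) := by
  have hK : 0 < c + a₁ + α := by positivity
  have h1 : ∀ i : ℕ, 0 < a₁ + i * α := fun i => by positivity
  have hlim : Tendsto (fun n : ℕ => Real.exp (-(c / (c + a₁ + α) *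
      ∑ i ∈ Finset.range n, (1 / (i + 1) : ℝ)))) atTop (𝓝 0) :=
    Real.tendsto_exp_neg_atTop_nhds_zero.comp
      (Real.tendsto_sum_range_one_div_nat_succ_atTop.const_mul_atTop (div_pos hc hK))
  refine squeeze_zero (fun n => Finset.prod_nonneg fun i _ => ?_) (fun n => ?_) hlim
  · have := h1 i
    positivity
  · rw [Finset.mul_sum, ← Finset.sum_neg_distrib, Real.exp_sum]
    refine Finset.prod_le_prod (fun i _ => ?_) fun i _ => ?_
    · have := h1 i
      positivity
    · have hi := h1 i
      have e : (a₁ + i * α) / (c + (a₁ + i * α)) = 1 - c / (c + (a₁ + i * α)) := by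
        field_simp
        ring
      rw [e]
      refine (Real.one_sub_le_exp_neg _).trans (Real.exp_le_exp.2 (neg_le_neg ?_))
      rw [div_mul_div_comm, mul_one]
      refine div_le_div_of_nonneg_left hc.le (by positivity) ?_
      have : (0 : ℝ) ≤ i := Nat.cast_nonneg i
      nlinarith

lemma ae_tendsto_prod_one_sub (hα : 0 ≤ α) (ha : 0 < a₁) (hc : 0 < c) :
    ∀ᵐ y ∂(Measure.infinitePi fun n : ℕ => betaMeasure c (a₁ + n * α)),
      Tendsto (fun n => ∏ i ∈ Finset.range n, (1 - y i)) atTop (𝓝 0) := by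
  have hb : ∀ i : ℕ, 0 < a₁ + i * α := fun i => by positivity
  have : ∀ n : ℕ, IsProbabilityMeasure (betaMeasure c (a₁ + n * α)) := fun n =>
    isProbabilityMeasureBeta hc (hb n)
  set Q := Measure.infinitePi fun n : ℕ => betaMeasure c (a₁ + n * α) with hQ
  have hmem : ∀ᵐ y ∂Q, ∀ n, y n ∈ Ioo (0 : ℝ) 1 := ae_all_iff.2 fun n =>
    (measurePreserving_eval_infinitePi (fun n : ℕ => betaMeasure c (a₁ + n * α)) n
      ).quasiMeasurePreserving.ae (ae_mem_Ioo_betaMeasure _ _)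
  have hE : ∀ n, ∫⁻ y, ∏ i ∈ Finset.range n, ENNReal.ofReal (1 - y i) ∂Q =
      ENNReal.ofReal (∏ i ∈ Finset.range n, ((a₁ + i * α) / (c + (a₁ + i * α)))) := by
    intro n
    rw [lintegral_prod_eq_prod_lintegral_of_indepFun (Finset.range n)
      (fun i (y : ℕ → ℝ) => ENNReal.ofReal (1 - y i))
      (iIndepFun_infinitePi (X := fun _ y => ENNReal.ofReal (1 - y)) fun i => by fun_prop)
      (fun i => by fun_prop), ENNReal.ofReal_prod_of_nonneg fun i _ => by
        have := hb i
        positivity]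
    refine Finset.prod_congr rfl fun i _ => ?_
    rw [← lintegral_one_sub_betaMeasure hc (hb i),
      ← (measurePreserving_eval_infinitePi (fun n : ℕ => betaMeasure c (a₁ + n * α)) i).map_eq,
      lintegral_map (by fun_prop) (by fun_prop)]
  have h0 := ae_tendsto_zero_of_antitone (P := Q)
    (f := fun n y => ∏ i ∈ Finset.range n, ENNReal.ofReal (1 - y i)) (fun n => by fun_prop)
    (hmem.mono fun y hy => antitone_nat_of_succ_le fun n => by
      rw [Finset.prod_range_succ]
      exact mul_le_of_le_one_right' (ENNReal.ofReal_le_one.2 (by linarith [(hy n).1])))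
    (by
      simp only [hE]
      have h := ENNReal.tendsto_ofReal (tendsto_prod_beta_mean hα ha hc)
      rwa [ENNReal.ofReal_zero] at h)
  filter_upwards [h0, hmem] with y hy hy1
  have h1 : ∀ i, 0 ≤ 1 - y i := fun i => by linarith [(hy1 i).2]
  have h2 := (ENNReal.tendsto_toReal ENNReal.zero_ne_top).comp hy
  refine h2.congr fun n => ?_
  rw [Function.comp_apply, ENNReal.toReal_prod]
  exact Finset.prod_congr rfl fun i _ => ENNReal.toReal_ofReal (h1 i)

lemma hasSum_stickBreaking {y : ℕ → ℝ} (hy : ∀ n, y n ∈ Ioo (0 : ℝ) 1)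
    (h : Tendsto (fun n => ∏ i ∈ Finset.range n, (1 - y i)) atTop (𝓝 0)) :
    HasSum (stickBreaking y) 1 := by
  have h0 : ∀ n, 0 ≤ stickBreaking y n := fun n => mul_nonneg
    (Finset.prod_nonneg fun i _ => (sub_pos.2 (hy i).2).le) (hy n).1.le
  rw [hasSum_iff_tendsto_nat_of_nonneg h0]
  have e : ∀ n, ∑ i ∈ Finset.range n, stickBreaking y i =
      1 - ∏ i ∈ Finset.range n, (1 - y i) := by
    intro n
    induction n with
    | zero => simp
    | succ n ih =>
      rw [Finset.sum_range_succ, ih, Finset.prod_range_succ, stickBreaking]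
      ring
  simp only [e]
  simpa using h.const_sub 1

/-- If `sₙ₊₁ = (1 - yₙ) sₙ + xₙ`, then with `gₙ = yₙ sₙ` and `uₙ = (1 - yₙ) sₙ / sₙ₊₁` the products
telescope, and `(gₙ u₀ ⋯ uₙ₋₁)ₙ` is proportional to the stick-breaking sequence of `y`. -/
lemma perpetuityTerms_eq_stickBreaking {s y : ℕ → ℝ} (hs : ∀ n, s n ≠ 0) :
    perpetuityTerms (fun n => y n * s n) (fun n => (1 - y n) * s n / s (n + 1)) =
      fun n => s 0 * stickBreaking y n := by
  have h : ∀ n, (∏ i ∈ Finset.range n, ((1 - y i) * s i / s (i + 1))) * s n =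
      s 0 * ∏ i ∈ Finset.range n, (1 - y i) := by
    intro n
    induction n with
    | zero => simp
    | succ n ih =>
      rw [Finset.prod_range_succ, Finset.prod_range_succ, ← mul_assoc, ← ih, mul_assoc,
        div_mul_cancel₀ _ (hs (n + 1))]
      ring
  funext n
  rw [perpetuityTerms, stickBreaking, ← mul_assoc, ← h]
  ring

/-- The state `S` of the stick-breaking recursion `Sₙ₊₁ = (1 - Yₙ) Sₙ + Xₙ`. -/
def stickState : ℕ → ℝ × (ℕ → ℝ × ℝ) → ℝ := chain fun _ s x => (1 - x.1) * s + x.2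

/-- The law of the initial state and of the innovations `(Yₙ, Xₙ)` of the stick-breaking
recursion. -/
def stickLaw (α a₁ c : ℝ) : Measure (ℝ × (ℕ → ℝ × ℝ)) :=
  (gammaMeasure (c + a₁) 1).prod
    (Measure.infinitePi fun n : ℕ => (betaMeasure c (a₁ + n * α)).prod (gammaMeasure (c + α) 1))

/-- The pairs `(Yₙ Sₙ, (1 - Yₙ) Sₙ / Sₙ₊₁)` produced by the stick-breaking recursion. -/
def stickOutput (ω : ℝ × (ℕ → ℝ × ℝ)) : ℕ → ℝ × ℝ := fun n =>
  ((ω.2 n).1 * stickState n ω, (1 - (ω.2 n).1) * stickState n ω / stickState (n + 1) ω)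

lemma measurable_stickState (n : ℕ) : Measurable (stickState n) :=
  measurable_chain (fun _ => by unfold Function.uncurry; fun_prop) n

lemma measurable_stickOutput : Measurable stickOutput := by
  have := measurable_stickState
  refine measurable_pi_lambda _ fun n => ?_
  unfold stickOutput
  fun_prop

lemma isProbabilityMeasure_stickLaw (hα : 0 ≤ α) (ha : 0 < a₁) (hc : 0 < c) :
    IsProbabilityMeasure (stickLaw α a₁ c) := by
  have := isProbabilityMeasure_gammaMeasure (add_pos hc ha) one_pos
  have := isProbabilityMeasure_gammaMeasure (add_pos_of_pos_of_nonneg hc hα) one_pos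
  have : ∀ n : ℕ, IsProbabilityMeasure (betaMeasure c (a₁ + n * α)) := fun n =>
    isProbabilityMeasureBeta hc (by positivity)
  unfold stickLaw
  infer_instance

lemma ae_stickLaw (hα : 0 ≤ α) (ha : 0 < a₁) (hc : 0 < c) : ∀ᵐ ω ∂(stickLaw α a₁ c),
    0 < ω.1 ∧ ∀ n, (ω.2 n).1 ∈ Ioo (0 : ℝ) 1 ∧ 0 < (ω.2 n).2 := by
  have hb : ∀ n : ℕ, 0 < a₁ + n * α := fun n => by positivity
  have := isProbabilityMeasure_gammaMeasure (add_pos hc ha) one_pos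
  have := isProbabilityMeasure_gammaMeasure (add_pos_of_pos_of_nonneg hc hα) one_pos
  have : ∀ n : ℕ, IsProbabilityMeasure (betaMeasure c (a₁ + n * α)) := fun n =>
    isProbabilityMeasureBeta hc (hb n)
  let lam : ℕ → Measure (ℝ × ℝ) := fun n =>
    (betaMeasure c (a₁ + n * α)).prod (gammaMeasure (c + α) 1)
  have h1 : ∀ᵐ x ∂(Measure.infinitePi lam), ∀ n, (x n).1 ∈ Ioo (0 : ℝ) 1 ∧ 0 < (x n).2 :=
    ae_all_iff.2 fun n => (measurePreserving_eval_infinitePi lam n).quasiMeasurePreserving.ae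
      (p := fun q => q.1 ∈ Ioo (0 : ℝ) 1 ∧ 0 < q.2)
      ((Measure.quasiMeasurePreserving_fst.ae (ae_mem_Ioo_betaMeasure _ _)).and
        (Measure.quasiMeasurePreserving_snd.ae (ae_pos_gammaMeasure _)))
  exact (Measure.quasiMeasurePreserving_fst.ae (ae_pos_gammaMeasure _)).and
    (Measure.quasiMeasurePreserving_snd.ae h1)

lemma map_stickOutput (hα : 0 ≤ α) (ha : 0 < a₁) (hc : 0 < c) :
    (stickLaw α a₁ c).map stickOutput = ramLaw α a₁ c := by
  have hb : ∀ n : ℕ, 0 < a₁ + n * α := fun n => by positivity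
  have hcα : 0 < c + α := by positivity
  have := isProbabilityMeasure_gammaMeasure hc one_pos
  have := isProbabilityMeasure_gammaMeasure hcα one_pos
  have : ∀ n : ℕ, IsProbabilityMeasure (betaMeasure c (a₁ + n * α)) := fun n =>
    isProbabilityMeasureBeta hc (hb n)
  have : ∀ n : ℕ, IsProbabilityMeasure (betaMeasure (a₁ + n * α) (c + α)) := fun n =>
    isProbabilityMeasureBeta (hb n) hcα
  have : ∀ n : ℕ, IsProbabilityMeasure (gammaMeasure (c + (a₁ + n * α)) 1) := fun n =>
    isProbabilityMeasure_gammaMeasure (add_pos hc (hb n)) one_pos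
  have h := map_outputs_eq_infinitePi (φ := fun _ s (x : ℝ × ℝ) => (1 - x.1) * s + x.2)
    (o := fun _ s x => (x.1 * s, (1 - x.1) * s / ((1 - x.1) * s + x.2)))
    (sig := fun n : ℕ => gammaMeasure (c + (a₁ + n * α)) 1)
    (lam := fun n : ℕ => (betaMeasure c (a₁ + n * α)).prod (gammaMeasure (c + α) 1))
    (rho := fun n : ℕ => (gammaMeasure c 1).prod (betaMeasure (a₁ + n * α) (c + α)))
    (fun _ => by unfold Function.uncurry; fun_prop) (fun _ => by unfold Function.uncurry; fun_prop)
    fun n => by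
      have e : c + (a₁ + ((n + 1 : ℕ) : ℝ) * α) = a₁ + n * α + (c + α) := by
        push_cast
        ring
      rw [e]
      exact (measurePreserving_stick hc (hb n) hcα).map_eq
  simp only [Nat.cast_zero, zero_mul, add_zero] at h
  exact h

lemma map_stickLaw_fractions (hα : 0 ≤ α) (ha : 0 < a₁) (hc : 0 < c) :
    (stickLaw α a₁ c).map (fun ω n => (ω.2 n).1) =
      Measure.infinitePi fun n : ℕ => betaMeasure c (a₁ + n * α) := by
  have hb : ∀ n : ℕ, 0 < a₁ + n * α := fun n => by positivity
  have hcα : 0 < c + α := by positivity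
  have := isProbabilityMeasure_gammaMeasure (add_pos hc ha) one_pos
  have := isProbabilityMeasure_gammaMeasure hcα one_pos
  have : ∀ n : ℕ, IsProbabilityMeasure (betaMeasure c (a₁ + n * α)) := fun n =>
    isProbabilityMeasureBeta hc (hb n)
  have h : (fun (ω : ℝ × (ℕ → ℝ × ℝ)) n => (ω.2 n).1) =
      (fun (x : ℕ → ℝ × ℝ) n => (x n).1) ∘ Prod.snd := rfl
  rw [h, ← Measure.map_map (by fun_prop) (by fun_prop), stickLaw, Measure.map_snd_prod,
    measure_univ, one_smul, Measure.infinitePi_map_pi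
      (μ := fun n : ℕ => (betaMeasure c (a₁ + n * α)).prod (gammaMeasure (c + α) 1))
      (f := fun _ p => p.1) (fun _ => measurable_fst)]
  simp_rw [Measure.map_fst_prod, measure_univ, one_smul]

lemma stickState_pos {ω : ℝ × (ℕ → ℝ × ℝ)}
    (h : 0 < ω.1 ∧ ∀ n, (ω.2 n).1 ∈ Ioo (0 : ℝ) 1 ∧ 0 < (ω.2 n).2) (n : ℕ) :
    0 < stickState n ω := by
  induction n with
  | zero => exact h.1
  | succ n ih =>
    exact add_pos (mul_pos (sub_pos.2 (h.2 n).1.2) ih) (h.2 n).2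

lemma ae_hasSum_stickBreaking (hα : 0 ≤ α) (ha : 0 < a₁) (hc : 0 < c) :
    ∀ᵐ ω ∂(stickLaw α a₁ c), HasSum (stickBreaking fun n => (ω.2 n).1) 1 := by
  have h := ae_tendsto_prod_one_sub hα ha hc
  rw [← map_stickLaw_fractions hα ha hc] at h
  filter_upwards [ae_of_ae_map (by fun_prop) h, ae_stickLaw hα ha hc] with ω h1 h2
  exact hasSum_stickBreaking (fun n => (h2.2 n).1) h1

lemma ramTerms_stickOutput {ω : ℝ × (ℕ → ℝ × ℝ)}
    (h : 0 < ω.1 ∧ ∀ n, (ω.2 n).1 ∈ Ioo (0 : ℝ) 1 ∧ 0 < (ω.2 n).2) :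
    ramTerms (stickOutput ω) = fun n => ω.1 * stickBreaking (fun n => (ω.2 n).1) n :=
  perpetuityTerms_eq_stickBreaking (s := fun n => stickState n ω) (y := fun n => (ω.2 n).1)
    fun n => (stickState_pos h n).ne'

lemma ramPartition_stickOutput {ω : ℝ × (ℕ → ℝ × ℝ)}
    (h : 0 < ω.1 ∧ ∀ n, (ω.2 n).1 ∈ Ioo (0 : ℝ) 1 ∧ 0 < (ω.2 n).2)
    (h1 : HasSum (stickBreaking fun n => (ω.2 n).1) 1) :
    ramPartition (stickOutput ω) = pointMeasure (stickBreaking fun n => (ω.2 n).1) := by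
  rw [ramPartition, ramTerms_stickOutput h, normalizeSeq_const_mul h.1.ne']
  congr 1
  funext n
  rw [normalizeSeq, h1.tsum_eq, div_one]

lemma isProbabilityMeasure_ramLaw (hα : 0 ≤ α) (ha : 0 < a₁) (hc : 0 < c) :
    IsProbabilityMeasure (ramLaw α a₁ c) := by
  have := isProbabilityMeasure_gammaMeasure hc one_pos
  have : ∀ n : ℕ, IsProbabilityMeasure (betaMeasure (a₁ + n * α) (c + α)) := fun n =>
    isProbabilityMeasureBeta (by positivity) (add_pos_of_pos_of_nonneg hc hα)
  unfold ramLaw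
  infer_instance

/-- The terms `Gₙ Πₙ` are almost surely positive and summable, being in law proportional to a
stick-breaking sequence. -/
lemma ae_ramLaw (hα : 0 ≤ α) (ha : 0 < a₁) (hc : 0 < c) :
    ∀ᵐ w ∂(ramLaw α a₁ c), (∀ n, 0 < ramTerms w n) ∧ Summable (ramTerms w) := by
  have hterm : ∀ n, Measurable fun w => ramTerms w n := fun n =>
    (measurable_pi_apply n).comp measurable_ramTerms
  have h : ∀ᵐ w ∂(ramLaw α a₁ c), (∀ n, 0 < ramTerms w n) ∧
      ∑' n, ENNReal.ofReal (ramTerms w n) ≠ ∞ := by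
    rw [← map_stickOutput hα ha hc, ae_map_iff measurable_stickOutput.aemeasurable]
    · filter_upwards [ae_stickLaw hα ha hc, ae_hasSum_stickBreaking hα ha hc] with ω h1 h2
      rw [ramTerms_stickOutput h1]
      have h3 : ∀ n, 0 < ω.1 * stickBreaking (fun n => (ω.2 n).1) n := fun n =>
        mul_pos h1.1 (mul_pos (Finset.prod_pos fun i _ => sub_pos.2 (h1.2 i).1.2) (h1.2 n).1.1)
      exact ⟨h3, (h2.summable.mul_left _).tsum_ofReal_ne_top⟩
    · refine MeasurableSet.inter ?_ ?_
      · have e : {w : ℕ → ℝ × ℝ | ∀ n, 0 < ramTerms w n} = ⋂ n, {w | 0 < ramTerms w n} := by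
          ext w
          simp
        have e' : MeasurableSet {w : ℕ → ℝ × ℝ | ∀ n, 0 < ramTerms w n} := by
          rw [e]
          exact MeasurableSet.iInter fun n => measurableSet_lt measurable_const (hterm n)
        exact e'
      · exact ((Measurable.tsum fun n => (hterm n).ennreal_ofReal)
          (measurableSet_singleton ∞)).compl
  refine h.mono fun w hw => ⟨hw.1, ?_⟩
  have h3 := ENNReal.summable_toReal hw.2
  exact h3.congr fun n => ENNReal.toReal_ofReal (hw.1 n).le

/-- The RAM distribution has a stick-breaking representation: the recursion that produces `(Gₙ, Uₙ)`
is driven by beta fractions `Yₙ` whose stick-breaking sequence is the normalization of `(Gₙ Πₙ)`. -/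
theorem hasBetaStickBreaking_ramLaw (hα : 0 ≤ α) (ha : 0 < a₁) (hc : 0 < c) :
    HasBetaStickBreaking (fun _ => c) (fun n => a₁ + n * α)
      ((ramLaw α a₁ c).map ramPartition) := by
  have hb : ∀ n : ℕ, 0 < a₁ + n * α := fun n => by positivity
  have : ∀ n : ℕ, IsProbabilityMeasure (betaMeasure c (a₁ + n * α)) := fun n =>
    isProbabilityMeasureBeta hc (hb n)
  have := isProbabilityMeasure_stickLaw hα ha hc
  obtain ⟨h1, h2⟩ := iIndepFun_of_map_eq_infinitePi (P := stickLaw α a₁ c)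
    (X := fun n ω => (ω.2 n).1) (fun n => by fun_prop) (map_stickLaw_fractions hα ha hc)
  refine ⟨_, _, stickLaw α a₁ c, this, fun n ω => (ω.2 n).1, h1, fun n => ⟨by fun_prop, h2 n⟩,
    ae_hasSum_stickBreaking hα ha hc, ?_⟩
  have h3 : HasLaw (fun ω => ramPartition (stickOutput ω)) ((ramLaw α a₁ c).map ramPartition)
      (stickLaw α a₁ c) :=
    ⟨(measurable_ramPartition.comp measurable_stickOutput).aemeasurable, by
      rw [← map_stickOutput hα ha hc, Measure.map_map measurable_ramPartition
        measurable_stickOutput]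
      rfl⟩
  refine h3.congr ?_
  filter_upwards [ae_stickLaw hα ha hc, ae_hasSum_stickBreaking hα ha hc] with ω h4 h5
  exact (ramPartition_stickOutput h4 h5).symm

theorem isRAM_ramLaw (hα : 0 ≤ α) (ha : 0 < a₁) (hc : 0 < c) :
    IsRAM α a₁ c ((ramLaw α a₁ c).map ramPartition) := by
  have hb : ∀ n : ℕ, 0 < a₁ + n * α := fun n => by positivity
  have := isProbabilityMeasure_gammaMeasure hc one_pos
  have : ∀ n : ℕ, IsProbabilityMeasure (betaMeasure (a₁ + n * α) (c + α)) := fun n =>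
    isProbabilityMeasureBeta (hb n) (add_pos_of_pos_of_nonneg hc hα)
  have := isProbabilityMeasure_ramLaw hα ha hc
  obtain ⟨h1, h2⟩ := iIndepFun_of_map_eq_infinitePi (P := ramLaw α a₁ c) (X := fun n w => w n)
    (fun n => by fun_prop) Measure.map_id
  have hm1 : ∀ n, Measurable fun w : ℕ → ℝ × ℝ => (w n).1 := fun n => by fun_prop
  have hm2 : ∀ n, Measurable fun w : ℕ → ℝ × ℝ => (w n).2 := fun n => by fun_prop
  have hG : ∀ n, (ramLaw α a₁ c).map (fun w => (w n).1) = gammaMeasure c 1 := fun n => by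
    rw [← Function.comp_def Prod.fst, ← Measure.map_map measurable_fst (by fun_prop), h2 n,
      Measure.map_fst_prod, measure_univ, one_smul]
  have hU : ∀ n : ℕ, (ramLaw α a₁ c).map (fun w => (w n).2) = betaMeasure (a₁ + n * α) (c + α) :=
    fun n => by
      rw [← Function.comp_def Prod.snd, ← Measure.map_map measurable_snd (by fun_prop), h2 n,
        Measure.map_snd_prod, measure_univ, one_smul]
  refine ⟨_, _, ramLaw α a₁ c, this, fun n w => (w n).1, fun n w => (w n).2,
    iIndepFun_sumElim hm1 hm2 h1 fun n => ?_,
    fun n => ⟨(hm1 n).aemeasurable, hG n⟩, fun n => ⟨(hm2 n).aemeasurable, hU n⟩,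
    (ae_ramLaw hα ha hc).mono fun w hw => hw.2, ⟨measurable_ramPartition.aemeasurable, rfl⟩⟩
  rw [indepFun_iff_map_prod_eq_prod_map_map (hm1 n).aemeasurable
    (hm2 n).aemeasurable, hG, hU]
  exact h2 n

end Stick

/-! ### Poisson-Dirichlet distributions as residual allocation models -/

/-- If a random counting measure `m` has the law of `∑ₙ δ_{xₙ}`, where `(xₙ)` is proportional to the
terms of the residual allocation model, then its self-normalization has the RAM distribution. -/
lemma hasLaw_selfNormalize {Ω Ω' : Type*} [MeasurableSpace Ω] [MeasurableSpace Ω']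
    {P : Measure Ω} {P' : Measure Ω'} {α a₁ c : ℝ} (hα : 0 ≤ α) (ha : 0 < a₁) (hc : 0 < c)
    {m : Ω → Measure ℝ} (hm : Measurable m) {x : Ω' → ℕ → ℝ} (hx : Measurable x)
    {out : Ω' → ℕ → ℝ × ℝ} (hout : Measurable out)
    (h : P.map m = P'.map fun ω => pointMeasure (x ω)) (h' : P'.map out = ramLaw α a₁ c)
    (hk : ∀ᵐ ω ∂P', ∃ k : ℝ, 0 < k ∧ x ω = fun n => k * ramTerms (out ω) n) :
    HasLaw (fun ω => selfNormalize (m ω)) ((ramLaw α a₁ c).map ramPartition) P := by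
  have hp : Measurable fun ω => pointMeasure (x ω) := measurable_pointMeasure hx
  have hr := ae_ramLaw hα ha hc
  rw [← h'] at hr
  have hpos : ∀ᵐ ω ∂P', (∀ n, 0 < x ω n) ∧ Summable (x ω) := by
    filter_upwards [hk, ae_of_ae_map hout.aemeasurable hr] with ω ⟨k, hk0, hk⟩ hr
    rw [hk]
    exact ⟨fun n => mul_pos hk0 (hr.1 n), hr.2.mul_left k⟩
  have hQ : ∀ᵐ μ ∂(P.map m), μ ∈ normalizable := by
    rw [h]
    refine (ae_map_iff hp.aemeasurable measurableSet_normalizable).2 ?_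
    exact hpos.mono fun ω hω => pointMeasure_mem_normalizable hω.1 hω.2
  have hs := aemeasurable_selfNormalize hQ
  refine ⟨hs.comp_measurable hm, ?_⟩
  rw [show (fun ω => selfNormalize (m ω)) = selfNormalize ∘ m from rfl,
    ← AEMeasurable.map_map_of_aemeasurable hs hm.aemeasurable, h]
  rw [h] at hs
  rw [AEMeasurable.map_map_of_aemeasurable hs hp.aemeasurable, ← h',
    Measure.map_map measurable_ramPartition hout]
  refine Measure.map_congr ?_
  filter_upwards [hk, hpos] with ω ⟨k, hk0, hk⟩ hω
  rw [Function.comp_apply, Function.comp_apply, selfNormalize_pointMeasure hω.1 hω.2, hk,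
    normalizeSeq_const_mul hk0.ne', ramPartition]

/-- A change of probability by a function of `T` changes the law of `T` by that function. -/
lemma map_withDensity_comp {Ω E : Type*} [MeasurableSpace Ω] [MeasurableSpace E] {P : Measure Ω}
    {T : Ω → E} (hT : Measurable T) {d : E → ℝ≥0∞} (hd : Measurable d) :
    (P.withDensity fun ω => d (T ω)).map T = (P.map T).withDensity d := by
  refine Measure.ext fun s hs => ?_
  rw [Measure.map_apply hT hs, withDensity_apply _ (hT hs), withDensity_apply _ hs,
    setLIntegral_map hs hd hT]

section Zero

variable {θ : ℝ}

/-- The points `Gₙ e^{-Γₙ / θ}`, built from the arrival times `Γₙ` and the marks `Gₙ`. -/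
def gammaPoints (θ : ℝ) (ω : ℝ × (ℕ → ℝ × ℝ)) : ℕ → ℝ :=
  fun n => (ω.2 n).2 * Real.exp (-arrival n ω / θ)

/-- The pairs `(Gₙ, e^{-(Γₙ₊₁ - Γₙ) / θ})`. -/
def gammaOutput (θ : ℝ) (ω : ℝ × (ℕ → ℝ × ℝ)) : ℕ → ℝ × ℝ :=
  fun n => ((ω.2 n).2, Real.exp (-(ω.2 n).1 / θ))

lemma gammaPoints_eq (ω : ℝ × (ℕ → ℝ × ℝ)) :
    gammaPoints θ ω = fun n => Real.exp (-ω.1 / θ) * ramTerms (gammaOutput θ ω) n := by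
  have h : ∀ n, Real.exp (-arrival n ω / θ) =
      Real.exp (-ω.1 / θ) * ∏ i ∈ Finset.range n, Real.exp (-(ω.2 i).1 / θ) := by
    intro n
    induction n with
    | zero => simp [arrival, chain]
    | succ n ih =>
      rw [Finset.prod_range_succ, ← mul_assoc, ← ih, arrival_succ, ← Real.exp_add]
      ring_nf
  funext n
  rw [gammaPoints, h, ramTerms, perpetuityTerms]
  simp only [gammaOutput]
  ring

lemma map_gammaOutput (hθ : 0 < θ) :
    ((expMeasure 1).prod (innovationLaw (gammaMeasure 1 1))).map (gammaOutput θ) =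
      ramLaw 0 θ 1 := by
  have := isProbabilityMeasure_gammaMeasure one_pos one_pos
  have h : gammaOutput θ = (fun (x : ℕ → ℝ × ℝ) n => ((x n).2, Real.exp (-(x n).1 / θ))) ∘
      Prod.snd := rfl
  rw [h, ← Measure.map_map (by fun_prop) (by fun_prop), Measure.map_snd_prod, measure_univ,
    one_smul, innovationLaw, Measure.infinitePi_map_pi
      (μ := fun _ : ℕ => (expMeasure 1).prod (gammaMeasure 1 1))
      (f := fun _ p => (p.2, Real.exp (-p.1 / θ))) (fun _ => by fun_prop), ramLaw]
  simp only [mul_zero, add_zero]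
  congr 1
  funext _
  have m1 : MeasurePreserving (fun x : ℝ => Real.exp (-x / θ)) (expMeasure 1) (betaMeasure θ 1) :=
    ⟨by fun_prop, map_exp_neg_expMeasure hθ⟩
  exact (((MeasurePreserving.id (gammaMeasure 1 1)).prod m1).comp
    Measure.measurePreserving_swap).map_eq

/-- The normalized jumps of the gamma subordinator form a residual allocation model. -/
theorem IsPoissonProcess.hasLaw_selfNormalize_jumps (hθ : 0 < θ) {Ω : Type} [MeasurableSpace Ω]
    {P : Measure Ω} {N : Ω → Measure (ℝ × ℝ)}
    (h : IsPoissonProcess N (timeMeasure.prod gammaLevy) P) :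
    HasLaw (fun ω => selfNormalize (MassPartition.jumps θ (N ω)))
      ((ramLaw 0 θ 1).map ramPartition) P := by
  have := isProbabilityMeasure_gammaMeasure one_pos one_pos
  have h1 := h.jumps θ
  have h2 := (isPoissonProcess_markedPoint (gammaMeasure 1 1)).map
    (f := fun q => q.2 * Real.exp (-q.1 / θ)) (by fun_prop)
  rw [map_exp_mul_eq_gammaLevy hθ] at h2
  have h3 : ∀ ω : ℝ × (ℕ → ℝ × ℝ), (Measure.sum fun n => Measure.dirac (markedPoint n ω)).map
      (fun q : ℝ × ℝ => q.2 * Real.exp (-q.1 / θ)) = pointMeasure (gammaPoints θ ω) := by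
    intro ω
    rw [Measure.map_sum (by fun_prop), pointMeasure]
    congr 1
    funext n
    rw [Measure.map_dirac' (by fun_prop)]
    rfl
  simp only [h3] at h2
  refine hasLaw_selfNormalize le_rfl hθ one_pos h1.measurable (x := gammaPoints θ)
    (measurable_pi_lambda _ fun n => by unfold gammaPoints; fun_prop)
    (measurable_pi_lambda _ fun n => by unfold gammaOutput; fun_prop) (h1.map_eq h2)
    (map_gammaOutput hθ) (ae_of_all _ fun ω => ⟨_, Real.exp_pos _, gammaPoints_eq ω⟩)

end Zero

section Pos

variable {α θ : ℝ}

/-- The points `Gₙ Γₙ^{-1/α}`, built from the arrival times `Γₙ` and the marks `Gₙ`. -/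
def stablePoints (α : ℝ) (ω : ℝ × (ℕ → ℝ × ℝ)) : ℕ → ℝ :=
  fun n => (ω.2 n).2 / arrival n ω ^ α⁻¹

/-- The pairs `(Gₙ, (Γₙ / Γₙ₊₁)^{1/α})`. -/
def stableOutput (α : ℝ) (ω : ℝ × (ℕ → ℝ × ℝ)) : ℕ → ℝ × ℝ :=
  fun n => ((ω.2 n).2, (arrival n ω / arrival (n + 1) ω) ^ α⁻¹)

lemma stablePoints_eq {ω : ℝ × (ℕ → ℝ × ℝ)} (h : ∀ n, 0 < arrival n ω) :
    stablePoints α ω = fun n => (ω.1 ^ α⁻¹)⁻¹ * ramTerms (stableOutput α ω) n := by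
  have h1 : ∀ n, (arrival n ω ^ α⁻¹)⁻¹ = (ω.1 ^ α⁻¹)⁻¹ *
      ∏ i ∈ Finset.range n, (arrival i ω / arrival (i + 1) ω) ^ α⁻¹ := by
    intro n
    induction n with
    | zero => simp [arrival, chain]
    | succ n ih =>
      have h2 := Real.rpow_pos_of_pos (h n) α⁻¹
      rw [Finset.prod_range_succ, ← mul_assoc, ← ih, Real.div_rpow (h n).le (h (n + 1)).le,
        div_eq_mul_inv, inv_mul_cancel_left₀ h2.ne']
  funext n
  rw [stablePoints, div_eq_mul_inv, h1, ramTerms, perpetuityTerms]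
  simp only [stableOutput]
  ring

/-- Tilting by a power turns the first arrival time into a gamma variable with another
parameter. -/
lemma expMeasure_withDensity_rpow (h : 0 < θ / α + 1) :
    (expMeasure 1).withDensity
      (fun x => ENNReal.ofReal ((x ^ α⁻¹) ^ θ / Real.Gamma (θ / α + 1))) =
      gammaMeasure (θ / α + 1) 1 := by
  refine Measure.ext_of_lintegral _ fun F hF => ?_
  rw [lintegral_withDensity_eq_lintegral_mul _ (by fun_prop) hF, lintegral_expMeasure
    (by fun_prop), lintegral_gammaMeasure _ hF]
  refine setLIntegral_congr_fun measurableSet_Ioi fun x hx => ?_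
  have hx : 0 < x := hx
  have hΓ := Real.Gamma_pos_of_pos h
  rw [Pi.mul_apply, ← mul_assoc, ← ENNReal.ofReal_mul (by positivity)]
  congr 2
  rw [← Real.rpow_mul hx.le, add_sub_cancel_right, ← div_eq_inv_mul]
  ring

/-- The tilted arrival times satisfy `Γₙ ∼ gamma(θ/α + 1 + n)`, and the ratios `Γₙ / Γₙ₊₁` are
independent with laws `beta(θ/α + 1 + n, 1)`. -/
lemma map_stableOutput (hα₀ : 0 < α) (hα₁ : α < 1) (hθ : 0 < θ + α) :
    ((gammaMeasure (θ / α + 1) 1).prod (innovationLaw (gammaMeasure (1 - α) 1))).map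
      (stableOutput α) = ramLaw α (α + θ) (1 - α) := by
  have h0 : 0 < θ / α + 1 := by
    rw [div_add_one hα₀.ne']
    positivity
  have hn : ∀ n : ℕ, 0 < θ / α + 1 + n := fun n => by positivity
  have hα : 0 < 1 - α := sub_pos.2 hα₁
  have := isProbabilityMeasure_gammaMeasure hα one_pos
  have : ∀ n : ℕ, IsProbabilityMeasure (gammaMeasure (θ / α + 1 + n) 1) := fun n =>
    isProbabilityMeasure_gammaMeasure (hn n) one_pos
  have hb : ∀ n : ℕ, IsProbabilityMeasure (betaMeasure (α + θ + n * α) (1 - α + α)) := fun n =>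
    isProbabilityMeasureBeta (by have : 0 < α + θ := by linarith
                                 positivity) (by simp)
  have h := map_outputs_eq_infinitePi (φ := fun _ s (x : ℝ × ℝ) => s + x.1)
    (o := fun _ s x => (x.2, (s / (s + x.1)) ^ α⁻¹))
    (sig := fun n : ℕ => gammaMeasure (θ / α + 1 + n) 1)
    (lam := fun _ => (expMeasure 1).prod (gammaMeasure (1 - α) 1))
    (rho := fun n : ℕ => (gammaMeasure (1 - α) 1).prod (betaMeasure (α + θ + n * α) (1 - α + α)))
    (fun _ => by unfold Function.uncurry; fun_prop) (fun _ => by unfold Function.uncurry; fun_prop)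
    fun n => by
      have m1 : MeasurePreserving (fun x : ℝ => x ^ α⁻¹) (betaMeasure (θ / α + 1 + n) 1)
          (betaMeasure (α + θ + n * α) (1 - α + α)) := by
        refine ⟨by fun_prop, ?_⟩
        rw [map_rpow_betaMeasure hα₀ (hn n), sub_add_cancel]
        congr 1
        field_simp
        ring
      have := isProbabilityMeasureBeta (hn n) one_pos
      have := isProbabilityMeasure_gammaMeasure (add_pos (hn n) one_pos) one_pos
      have := isProbabilityMeasure_gammaMeasure one_pos one_pos
      have m2 := (m1.prod (MeasurePreserving.id (gammaMeasure (θ / α + 1 + n + 1) 1))).comp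
        (measurePreserving_gamma_ratio (hn n) one_pos)
      have m3 := MeasurePreserving.prod_mark (μE := gammaMeasure (1 - α) 1) m2
      rw [Nat.cast_add, Nat.cast_one, ← add_assoc]
      exact m3.map_eq
  simp only [Nat.cast_zero, add_zero] at h
  exact h

/-- The normalized jumps of the stable subordinator form, after the change of probability, a
residual allocation model. -/
theorem IsPoissonProcess.hasLaw_selfNormalize_sizeBiasMarks (hα₀ : 0 < α) (hα₁ : α < 1)
    (hθ : 0 < θ + α) {Ω : Type} [MeasurableSpace Ω] {P : Measure Ω}
    {M : Ω → Measure (ℝ × ℝ × ℝ)}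
    (h : IsPoissonProcess M (timeMeasure.prod ((stableLevy α).prod (expMeasure 1))) P) :
    HasLaw (fun ω => selfNormalize ((MassPartition.sizeBiasMarks (M ω)).map Prod.snd))
      ((ramLaw α (α + θ) (1 - α)).map ramPartition)
      (P.withDensity fun ω => ENNReal.ofReal
        (firstMark (MassPartition.sizeBiasMarks (M ω)) ^ θ / Real.Gamma (θ / α + 1))) := by
  have h0 : 0 < θ / α + 1 := by
    rw [div_add_one hα₀.ne']
    positivity
  have hα : 0 < 1 - α := sub_pos.2 hα₁
  have := isProbabilityMeasure_gammaMeasure hα one_pos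
  have := isProbabilityMeasure_gammaMeasure h0 one_pos
  have h1 := h.sizeBiasMarks
  rw [map_sizeBias_stableLevy hα₀ hα₁] at h1
  have h2 := (isPoissonProcess_markedPoint (gammaMeasure (1 - α) 1)).map
    (f := fun q => (q.1 ^ α⁻¹, q.2 / q.1 ^ α⁻¹)) (by fun_prop)
  set Pc := (expMeasure 1).prod (innovationLaw (gammaMeasure (1 - α) 1)) with hPc
  let marks : ℝ × (ℕ → ℝ × ℝ) → Measure (ℝ × ℝ) := fun ω =>
    Measure.sum fun n => Measure.dirac (arrival n ω ^ α⁻¹, stablePoints α ω n)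
  have h3 : ∀ ω : ℝ × (ℕ → ℝ × ℝ), (Measure.sum fun n => Measure.dirac (markedPoint n ω)).map
      (fun q : ℝ × ℝ => (q.1 ^ α⁻¹, q.2 / q.1 ^ α⁻¹)) = marks ω := by
    intro ω
    rw [Measure.map_sum (by fun_prop)]
    congr 1
    funext n
    rw [Measure.map_dirac' (by fun_prop)]
    rfl
  simp only [h3] at h2
  have h4 := h1.map_eq h2
  let d : Measure (ℝ × ℝ) → ℝ≥0∞ := fun m =>
    ENNReal.ofReal (firstMark m ^ θ / Real.Gamma (θ / α + 1))
  have hd : Measurable d := ((measurable_firstMark.pow_const θ).div_const _).ennreal_ofReal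
  have hpos : ∀ᵐ ω ∂Pc, (∀ n, 0 < arrival n ω) ∧ StrictMono fun n => arrival n ω := by
    have := Measure.quasiMeasurePreserving_fst (ν := innovationLaw (gammaMeasure (1 - α) 1)).ae
      (ae_pos_gammaMeasure 1)
    filter_upwards [this, ae_strictMono_arrival (gammaMeasure (1 - α) 1) (expMeasure 1)] with ω h5 h6
    exact ⟨fun n => h5.trans_le (h6.monotone n.zero_le), h6⟩
  -- the first mark is a power of the first arrival time, so that the tilt acts on it alone
  have htilt : Pc.withDensity (fun ω => d (marks ω)) =
      (gammaMeasure (θ / α + 1) 1).prod (innovationLaw (gammaMeasure (1 - α) 1)) := by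
    have e : (fun ω => d (marks ω)) =ᵐ[Pc] fun ω =>
        ENNReal.ofReal ((ω.1 ^ α⁻¹) ^ θ / Real.Gamma (θ / α + 1)) := by
      filter_upwards [hpos] with ω hω
      have h5 : StrictMono fun n => arrival n ω ^ α⁻¹ := fun i j hij =>
        Real.rpow_lt_rpow (hω.1 i).le (hω.2 hij) (inv_pos.2 hα₀)
      simp only [d, marks]
      rw [firstMark_sum_dirac h5]
      rfl
    rw [withDensity_congr_ae e, hPc, ← expMeasure_withDensity_rpow h0,
      prod_withDensity_left (by fun_prop)]
  have hmap : (P.withDensity fun ω => d (MassPartition.sizeBiasMarks (M ω))).map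
      (fun ω => MassPartition.sizeBiasMarks (M ω)) =
      ((gammaMeasure (θ / α + 1) 1).prod (innovationLaw (gammaMeasure (1 - α) 1))).map marks := by
    rw [map_withDensity_comp h1.measurable hd, h4, ← htilt, map_withDensity_comp h2.measurable hd]
  have hsnd : Measurable fun m : Measure (ℝ × ℝ) => m.map Prod.snd :=
    Measure.measurable_map _ measurable_snd
  have h5 : ∀ ω, (marks ω).map Prod.snd = pointMeasure (stablePoints α ω) := by
    intro ω
    rw [Measure.map_sum (by fun_prop), pointMeasure]
    congr 1
    funext n
    rw [Measure.map_dirac' (by fun_prop)]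
  refine hasLaw_selfNormalize hα₀.le (by linarith) hα (hsnd.comp h1.measurable)
    (x := stablePoints α) (measurable_pi_lambda _ fun n => by unfold stablePoints; fun_prop)
    (measurable_pi_lambda _ fun n => by unfold stableOutput; fun_prop) ?_
    (map_stableOutput hα₀ hα₁ hθ) ?_
  · have h6 := congrArg (fun m => m.map fun m : Measure (ℝ × ℝ) => m.map Prod.snd) hmap
    rw [Measure.map_map hsnd h1.measurable, Measure.map_map hsnd h2.measurable] at h6
    simpa only [Function.comp_def, h5] using h6
  · rw [← htilt]
    refine (withDensity_absolutelyContinuous _ _).ae_le ?_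
    filter_upwards [hpos] with ω hω
    exact ⟨_, inv_pos.2 (Real.rpow_pos_of_pos (hω.1 0) _), stablePoints_eq hω.1⟩

end Pos

/-! ### Existence -/

lemma withDensity_Ioi_ne_zero {f : ℝ → ℝ} (hf : Measurable f) (h : ∀ x, 0 < x → 0 < f x) :
    (volume.restrict (Ioi 0)).withDensity (fun x => ENNReal.ofReal (f x)) ≠ 0 := by
  intro h0
  rw [withDensity_eq_zero_iff (by fun_prop)] at h0
  have h1 : ∀ᵐ x ∂(volume.restrict (Ioi (0 : ℝ))), x ∉ Ioi (0 : ℝ) := by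
    filter_upwards [h0] with x hx hx0
    exact (ENNReal.ofReal_pos.2 (h x hx0)).ne' hx
  have h2 : ∀ᵐ x ∂(volume.restrict (Ioi (0 : ℝ))), False := by
    filter_upwards [h1, ae_restrict_mem measurableSet_Ioi] with x hx hx0 using hx hx0
  have h3 := Measure.restrict_eq_zero.1 (ae_eq_bot.1 (eventually_false_iff_eq_bot.1 h2))
  rw [Real.volume_Ioi] at h3
  exact ENNReal.top_ne_zero h3

lemma prod_ne_zero_of_ne_zero {X Y : Type*} [MeasurableSpace X] [MeasurableSpace Y]
    {μ : Measure X} {ν : Measure Y} [SFinite ν] (hμ : μ ≠ 0) (hν : ν ≠ 0) : μ.prod ν ≠ 0 := by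
  rw [← Measure.measure_univ_ne_zero] at *
  rw [← univ_prod_univ, Measure.prod_prod]
  exact mul_ne_zero hμ hν

lemma timeMeasure_ne_zero : timeMeasure ≠ 0 := by
  simp [timeMeasure]

lemma gammaLevy_ne_zero : gammaLevy ≠ 0 :=
  withDensity_Ioi_ne_zero (by fun_prop) fun x hx => by positivity

lemma stableLevy_ne_zero {α : ℝ} (hα₀ : 0 < α) (hα₁ : α < 1) : stableLevy α ≠ 0 :=
  withDensity_Ioi_ne_zero (by fun_prop) fun x hx => by
    have := Real.Gamma_pos_of_pos (sub_pos.2 hα₁)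
    positivity

/-- The Poisson-Dirichlet distribution exists, and it is the RAM distribution. -/
theorem isPoissonDirichlet_iff {α θ : ℝ} (hα₀ : 0 ≤ α) (hα₁ : α < 1) (hθ : 0 < θ + α)
    {ν : Measure (Measure ℝ)} :
    IsPoissonDirichlet α θ ν ↔ ν = (ramLaw α (α + θ) (1 - α)).map ramPartition := by
  rcases hα₀.eq_or_lt with rfl | hα₀
  · simp only [IsPoissonDirichlet, true_and, ne_eq, not_true_eq_false, false_and, or_false,
      zero_add, sub_zero]
    rw [add_zero] at hθ
    constructor
    · rintro ⟨Ω, _, P, N, hN, hν⟩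
      rw [← hν.map_eq, (hN.hasLaw_selfNormalize_jumps hθ).map_eq]
    · rintro rfl
      have : NeZero (timeMeasure.prod gammaLevy) :=
        ⟨prod_ne_zero_of_ne_zero timeMeasure_ne_zero gammaLevy_ne_zero⟩
      obtain ⟨Ω, _, P, N, hN⟩ := exists_isPoissonProcess (timeMeasure.prod gammaLevy)
      exact ⟨Ω, _, P, N, hN, hN.hasLaw_selfNormalize_jumps hθ⟩
  · simp only [IsPoissonDirichlet, hα₀.ne', ne_eq, not_false_eq_true, true_and, false_and,
      false_or]
    constructor
    · rintro ⟨Ω, _, P, M, hM, hν⟩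
      rw [← hν.map_eq, (hM.hasLaw_selfNormalize_sizeBiasMarks hα₀ hα₁ hθ).map_eq]
    · rintro rfl
      have : NeZero (timeMeasure.prod ((stableLevy α).prod (expMeasure 1))) :=
        ⟨prod_ne_zero_of_ne_zero timeMeasure_ne_zero (prod_ne_zero_of_ne_zero
          (stableLevy_ne_zero hα₀ hα₁) (IsProbabilityMeasure.ne_zero _))⟩
      obtain ⟨Ω, _, P, M, hM⟩ :=
        exists_isPoissonProcess (timeMeasure.prod ((stableLevy α).prod (expMeasure 1)))
      exact ⟨Ω, _, P, M, hM, hM.hasLaw_selfNormalize_sizeBiasMarks hα₀ hα₁ hθ⟩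

end MassPartition

end

/-- For `0 ≤ α < 1` and `θ + α > 0` the `PD(α, θ)` distribution exists, has the stick-breaking
representation with independent `Yₙ ∼ beta(1 - α, nα + θ)`, `n ≥ 1`, and is `RAM(α, α + θ, 1 - α)`.
-/
theorem corollary2p4 (α θ : ℝ) (hα₀ : 0 ≤ α) (hα₁ : α < 1) (hθ : 0 < θ + α) :
    (∃ ν : Measure (Measure ℝ), MassPartition.IsPoissonDirichlet α θ ν) ∧
    ∀ ν : Measure (Measure ℝ), MassPartition.IsPoissonDirichlet α θ ν →
      MassPartition.HasBetaStickBreaking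
        (fun _ => 1 - α) (fun n => ((n : ℝ) + 1) * α + θ) ν ∧
      MassPartition.IsRAM α (α + θ) (1 - α) ν := by
  have ha : 0 < α + θ := by linarith
  have hc : 0 < 1 - α := sub_pos.2 hα₁
  refine ⟨⟨_, (MassPartition.isPoissonDirichlet_iff hα₀ hα₁ hθ).2 rfl⟩, fun ν hν => ?_⟩
  rw [MassPartition.isPoissonDirichlet_iff hα₀ hα₁ hθ] at hν
  subst hν
  refine ⟨?_, MassPartition.isRAM_ramLaw hα₀ ha hc⟩
  have e : (fun n : ℕ => ((n : ℝ) + 1) * α + θ) = fun n : ℕ => α + θ + n * α := by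
    funext n
    ring
  rw [e]
  exact MassPartition.hasBetaStickBreaking_ramLaw hα₀ ha hc
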